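/- Let $R$ be a (unital, associative) ring, let $\mathrm{Mod}(R)$ be the category of right $R$-modules, and let $\mathrm{mod}(R^{op})$ be the category of finitely presented left $R$-modules. All functors are additive. Let $\mathrm{fp}(\mathrm{Mod}(R),\mathrm{Ab})$ be the abelian category of finitely presented functors, i.e. of functors $F:\mathrm{Mod}(R)\to\mathrm{Ab}$ that admit an exact sequence $(Y,-)\to(X,-)\to F\to 0$, where $(X,-)=\mathrm{Hom}_R(X,-)$. Let $(\mathrm{mod}(R^{op}),\mathrm{Ab})$ be the abelian category of additive functors $\mathrm{mod}(R^{op})\to\mathrm{Ab}$. Let $\mathsf Y(X)=(X,-)$ be the contravariant Yoneda embedding, $w:\mathrm{fp}(\mathrm{Mod}(R),\mathrm{Ab})\to\mathrm{Mod}(R)$ its (contravariant) adjoint, $\mathrm{Nat}(F,(X,-))\cong(X,w(F))$, let $t(X)=X\otimes_R-$ and $\mathrm{ev}_R(G)=G(R)$. Put $$\mathsf D_A=R_0(t\circ w):\mathrm{fp}(\mathrm{Mod}(R),\mathrm{Ab})\to(\mathrm{mod}(R^{op}),\mathrm{Ab}),\qquad \mathsf D_L=L^0(\mathsf Y\circ\mathrm{ev}_R):(\mathrm{mod}(R^{op}),\mathrm{Ab})\to\mathrm{fp}(\mathrm{Mod}(R),\mathrm{Ab}),$$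 the zeroth right derived functor of the contravariant functor $t\circ w$ (computed by projective presentations) and the zeroth left derived functor of the contravariant functor $\mathsf Y\circ\mathrm{ev}_R$ (computed by injective copresentations). For $X\in\mathrm{Mod}(R)$ let $\gamma_{(X,-)}:\mathsf D_L\mathsf D_A(X,-)\to(X,-)$ be the canonical morphism $L^0(\mathsf Y\circ\mathrm{ev}_R)\to\mathsf Y\circ\mathrm{ev}_R$ evaluated at $X\otimes_R-$, under the canonical identifications $\mathsf D_A(X,-)\cong X\otimes_R-$ and $X\otimes_R R\cong X$. There is a natural transformation $\gamma:\mathsf D_L\mathsf D_A\to 1$ whose component $\gamma_F$ at each finitely presented $F$ is, for every presentation $(Z,-)\to(X,-)\xrightarrow{\varepsilon}F\to0$, the unique morphism with $\gamma_F\circ\mathsf D_L\mathsf D_A(\varepsilon)=\varepsilon\circ\gamma_{(X,-)}$. For every $F\in\mathrm{fp}(\mathrm{Mod}(R),\mathrm{Ab})$ there is an exact sequence in $\mathrm{fp}(\mathrm{Mod}(R),\mathrm{Ab})$ $$0\to F_p\to\mathsf D_L\mathsf D_A(F)\xrightarrow{\gamma_F}F\to F^p\to0,$$ and this sequence is functorial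 in $F$: $F\mapsto F_p$ and $F\mapsto F^p$ are functors and all the maps are natural in $F$. Moreover $\mathsf D_A(F_p)\cong\mathsf D_A(F^p)\cong0$, and $F_p$ and $F^p$ arise from pure exact sequences. Here a functor $G$ arises from a pure exact sequence if there are a short exact sequence $0\to X\to Y\to Z\to0$ of right $R$-modules such that $0\to X\otimes_R-\to Y\otimes_R-\to Z\otimes_R-\to0$ is exact in $(\mathrm{mod}(R^{op}),\mathrm{Ab})$, and an exact sequence $0\to(Z,-)\to(Y,-)\to(X,-)\to G\to0$. -/

import Mathlib

open CategoryTheory CategoryTheory.Limits Opposite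
open scoped TensorProduct ZeroObject
universe v u

noncomputable section
namespace AGJ

/-! ### Additive functors to abelian groups form an abelian category with enough injectives -/

section AdditiveFunctors

variable {C : Type u} [Category.{v} C] [Preadditive C]

instance additiveFunctor_containsZero :
    (additiveFunctor C AddCommGrpCat.{v}).ContainsZero where
  exists_zero := ⟨0, isZero_zero _, (inferInstance : Functor.Additive (0 : C ⥤ AddCommGrpCat.{v}))⟩

instance additiveFunctor_subobjects :
    (additiveFunctor C AddCommGrpCat.{v}).IsClosedUnderSubobjects where
  prop_of_mono {F G} i _ hG := by
    have : G.Additive := hG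
    refine ⟨fun {X Y f g} => ?_⟩
    rw [← cancel_mono (i.app Y)]
    simp [Functor.map_add]

instance additiveFunctor_quotients :
    (additiveFunctor C AddCommGrpCat.{v}).IsClosedUnderQuotients where
  prop_of_epi {F G} p _ hF := by
    have : F.Additive := hF
    refine ⟨fun {X Y f g} => ?_⟩
    rw [← cancel_epi (p.app X)]
    simp only [← NatTrans.naturality, Functor.map_add, Preadditive.comp_add, Preadditive.add_comp]

instance additiveFunctor_finiteProducts :
    (additiveFunctor C AddCommGrpCat.{v}).IsClosedUnderFiniteProducts where
  isClosedUnderLimitsOfShape J _ := ⟨by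
    rintro F ⟨p⟩
    refine ⟨fun {X Y f g} => ?_⟩
    have h := isLimitOfPreserves ((evaluation C AddCommGrpCat.{v}).obj Y) p.isLimit
    refine h.hom_ext fun j => ?_
    have : (p.diag.obj j).Additive := p.prop_diag_obj j
    change F.map (f + g) ≫ (p.π.app j).app Y = (F.map f + F.map g) ≫ (p.π.app j).app Y
    have e := fun k : X ⟶ Y => (p.π.app j).naturality k
    dsimp at e
    rw [Preadditive.add_comp, e, e, e, Functor.map_add, Preadditive.comp_add]⟩


lemma addFun_mono_injective {F G : C ⥤+ AddCommGrpCat.{v}} (i : F ⟶ G) [Mono i] (A : C) :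
    Function.Injective (i.hom.app A) := by
  have := (additiveFunctor C AddCommGrpCat.{v}).preservesMonomorphisms_ι_of_isNormalEpiCategory
  have h : Mono i.hom :=
    inferInstanceAs (Mono ((additiveFunctor C AddCommGrpCat.{v}).ι.map i))
  exact (AddCommGrpCat.mono_iff_injective _).1 ((NatTrans.mono_iff_mono_app _).1 h A)

lemma addFun_mono_of_injective {F G : C ⥤+ AddCommGrpCat.{v}} (i : F ⟶ G)
    (h : ∀ A, Function.Injective (i.hom.app A)) : Mono i := by
  have : Mono i.hom := (NatTrans.mono_iff_mono_app _).2
    fun A => (AddCommGrpCat.mono_iff_injective _).2 (h A)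
  exact (additiveFunctor C AddCommGrpCat.{v}).ι.mono_of_mono_map this

/-- The additive functor `A ↦ ∏ₗ Hom_ℤ (Hom (A, Lₗ), Iₗ)`. -/
def coindFunctor {T : Type v} (L : T → C) (I : T → AddCommGrpCat.{v}) :
    C ⥤+ AddCommGrpCat.{v} where
  obj :=
    { obj A := AddCommGrpCat.of (∀ l, (A ⟶ L l) →+ I l)
      map {A B} f := AddCommGrpCat.ofHom
        { toFun φ l :=
            { toFun h := φ l (f ≫ h)
              map_zero' := by simp
              map_add' := by simp }
          map_zero' := rfl
          map_add' _ _ := rfl }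
      map_id A := by ext φ l h; exact congrArg (φ l) (Category.id_comp h)
      map_comp f g := by ext φ l h; exact congrArg (φ l) (Category.assoc f g h) }
  property := ⟨fun {A B f g} => by
    ext φ l h; exact (congrArg (φ l) (Preadditive.add_comp _ _ _ f g h)).trans (map_add (φ l) _ _)⟩

/-- A family of maps `G (Lₗ) → Iₗ` induces a natural transformation to `coindFunctor L I`. -/
def toCoind {T : Type v} (L : T → C) (I : T → AddCommGrpCat.{v}) (G : C ⥤+ AddCommGrpCat.{v})
    (ψ : ∀ l, G.obj.obj (L l) ⟶ I l) : G ⟶ coindFunctor L I :=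
  ObjectProperty.homMk
    { app A := AddCommGrpCat.ofHom
        { toFun x l :=
            { toFun h := ψ l (G.obj.map h x)
              map_zero' := by simp
              map_add' h h' := by simp [Functor.map_add] }
          map_zero' := by funext l; ext h; simp
          map_add' x y := by funext l; ext h; simp }
      naturality A B f := by
        ext x; funext l; ext h
        change ψ l (G.obj.map h (G.obj.map f x)) = ψ l (G.obj.map (f ≫ h) x)
        simp }

lemma coindFunctor_injective {T : Type v} (L : T → C) (I : T → AddCommGrpCat.{v})
    [∀ l, Injective (I l)] : Injective (coindFunctor L I) where
  factors {G₁ G₂} φ i _ := by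
    have hm : ∀ l, Mono (i.hom.app (L l)) := fun l =>
      (AddCommGrpCat.mono_iff_injective _).2 (addFun_mono_injective i (L l))
    let φ' : ∀ l, G₁.obj.obj (L l) ⟶ I l := fun l => φ.hom.app (L l) ≫ AddCommGrpCat.ofHom
      { toFun x := x l (𝟙 (L l))
        map_zero' := rfl
        map_add' _ _ := rfl }
    refine ⟨toCoind L I G₂ fun l => Injective.factorThru (φ' l) (i.hom.app (L l)), ?_⟩
    ext A x
    funext l
    ext h
    have h1 := congr($(Injective.comp_factorThru (φ' l) (i.hom.app (L l))) (G₁.obj.map h x))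
    have h2 := congr($(i.hom.naturality h) x)
    have h3 := congr($(φ.hom.naturality h) x)
    change Injective.factorThru (φ' l) (i.hom.app (L l)) (G₂.obj.map h (i.hom.app A x)) =
      φ.hom.app A x l h
    change Injective.factorThru (φ' l) (i.hom.app (L l)) (i.hom.app (L l) (G₁.obj.map h x)) =
      φ.hom.app (L l) (G₁.obj.map h x) l (𝟙 (L l)) at h1
    change i.hom.app (L l) (G₁.obj.map h x) = G₂.obj.map h (i.hom.app A x) at h2
    rw [← h2, h1]
    have h4 := DFunLike.congr_fun (congr_fun h3 l) (𝟙 (L l))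
    refine h4.trans ?_
    change φ.hom.app A x l (h ≫ 𝟙 _) = _
    rw [Category.comp_id]

instance addFun_enoughInjectives [EssentiallySmall.{v} C] :
    EnoughInjectives (C ⥤+ AddCommGrpCat.{v}) where
  presentation G := by
    let L : SmallModel.{v} C → C := (equivSmallModel C).inverse.obj
    let I : SmallModel.{v} C → AddCommGrpCat.{v} := fun l => Injective.under (G.obj.obj (L l))
    refine ⟨⟨coindFunctor L I, coindFunctor_injective L I,
      toCoind L I G fun l => Injective.ι _, addFun_mono_of_injective _ fun A x y hxy => ?_⟩⟩
    let e : A ≅ L ((equivSmallModel C).functor.obj A) := (equivSmallModel C).unitIso.app A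
    have h1 := DFunLike.congr_fun (congr_fun hxy ((equivSmallModel C).functor.obj A)) e.hom
    have h2 := (AddCommGrpCat.mono_iff_injective _).1 (Injective.ι_mono _) h1
    have h3 : IsIso (G.obj.map e.hom) := inferInstance
    exact (AddCommGrpCat.mono_iff_injective (G.obj.map e.hom)).1 inferInstance h2

end AdditiveFunctors

/-! ### Finitely presented functors -/

section Elements

variable {C : Type u} [Category.{v} C]

lemma fmap_comp (F : C ⥤ AddCommGrpCat.{v}) {A B D : C} (f : A ⟶ B) (g : B ⟶ D) (x : F.obj A) :
    F.map (f ≫ g) x = F.map g (F.map f x) := by simp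

lemma app_map {F G : C ⥤ AddCommGrpCat.{v}} (α : F ⟶ G) {A B : C} (f : A ⟶ B) (x : F.obj A) :
    α.app B (F.map f x) = G.map f (α.app A x) := congr($(α.naturality f) x)

lemma fmap_add [Preadditive C] (F : C ⥤ AddCommGrpCat.{v}) [F.Additive] {A B : C} (x : F.obj A)
    (f g : A ⟶ B) : F.map (f + g) x = F.map f x + F.map g x := by
  rw [Functor.map_add]; rfl

lemma fmap_zero [Preadditive C] (F : C ⥤ AddCommGrpCat.{v}) [F.Additive] {A B : C} (x : F.obj A) :
    F.map (0 : A ⟶ B) x = 0 := by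
  rw [Functor.map_zero]; rfl

lemma exact_app {F G H : C ⥤ AddCommGrpCat.{v}} {f : F ⟶ G} {g : G ⟶ H} {w : f ≫ g = 0}
    (h : (ShortComplex.mk f g w).Exact) (A : C) : Function.Exact (f.app A) (g.app A) :=
  (ShortComplex.ab_exact_iff_function_exact _).1
    (h.map ((evaluation C AddCommGrpCat.{v}).obj A))

end Elements

section FPFunctors

variable {C : Type u} [Category.{v} C] [Abelian C]

/-- The sequence `(Y, -) ⟶ (X, -) ⟶ F ⟶ 0` is exact at each object. -/
def IsPresentation {X Y : C} {F : C ⥤ AddCommGrpCat.{v}}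
    (η : preadditiveCoyoneda.obj (op Y) ⟶ preadditiveCoyoneda.obj (op X))
    (ε : preadditiveCoyoneda.obj (op X) ⟶ F) : Prop :=
  ∀ A : C, Function.Exact (η.app A) (ε.app A) ∧ Function.Surjective (ε.app A)

variable (C) in
/-- The finitely presented functors `C ⥤ Ab`. They are automatically additive, see
`isFPFunctor.additive`. -/
def isFPFunctor : ObjectProperty (C ⥤ AddCommGrpCat.{v}) := fun F =>
  ∃ (X Y : C) (η : preadditiveCoyoneda.obj (op Y) ⟶ preadditiveCoyoneda.obj (op X))
    (ε : preadditiveCoyoneda.obj (op X) ⟶ F), IsPresentation η ε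

lemma isFPFunctor.additive {F : C ⥤ AddCommGrpCat.{v}} (hF : isFPFunctor C F) : F.Additive := by
  obtain ⟨X, Y, η, ε, h⟩ := hF
  have : Epi ε := (NatTrans.epi_iff_epi_app _).2
    fun A => (AddCommGrpCat.epi_iff_surjective _).2 (h A).2
  exact (additiveFunctor C AddCommGrpCat.{v}).prop_of_epi ε
    (inferInstanceAs (Functor.Additive (preadditiveCoyoneda.obj (op X))))

/-- Finite presentation in terms of a generator `x ∈ F X` with relations `f : X ⟶ Y`. -/
lemma isFPFunctor_iff (F : C ⥤ AddCommGrpCat.{v}) [F.Additive] :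
    isFPFunctor C F ↔ ∃ (X Y : C) (f : X ⟶ Y) (x : F.obj X),
      (∀ A (y : F.obj A), ∃ a : X ⟶ A, F.map a x = y) ∧
      (∀ A (a : X ⟶ A), F.map a x = 0 ↔ ∃ b : Y ⟶ A, f ≫ b = a) := by
  constructor
  · rintro ⟨X, Y, η, ε, h⟩
    obtain ⟨f, rfl⟩ := preadditiveCoyoneda.map_surjective η
    have key : ∀ A (a : X ⟶ A), F.map a (ε.app X (𝟙 X)) = ε.app A a := fun A a => by
      have := congr($(ε.naturality a) (𝟙 X))
      refine this.symm.trans ?_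
      change ε.app A (𝟙 X ≫ a) = _
      rw [Category.id_comp]
    refine ⟨X, Y, f.unop, ε.app X (𝟙 X), fun A y => ?_, fun A a => ?_⟩
    · obtain ⟨a, ha⟩ := (h A).2 y
      exact ⟨a, (key A a).trans ha⟩
    · rw [key]
      exact (h A).1 a
  · rintro ⟨X, Y, f, x, hx, hf⟩
    refine ⟨X, Y, preadditiveCoyoneda.map f.op,
      { app A := AddCommGrpCat.ofHom
          { toFun := fun a : X ⟶ A => F.map a x
            map_zero' := fmap_zero F x
            map_add' := fmap_add F x }
        naturality A B g := by
          ext a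
          exact fmap_comp F a g x }, fun A => ⟨fun a => hf A a, fun y => hx A y⟩⟩

instance isFPFunctor_iso : (isFPFunctor C).IsClosedUnderIsomorphisms where
  of_iso := by
    rintro F G e ⟨X, Y, η, ε, h⟩
    have hb : ∀ A, Function.Bijective (e.hom.app A) := fun A =>
      ConcreteCategory.bijective_of_isIso (e.hom.app A)
    refine ⟨X, Y, η, ε ≫ e.hom, fun A => ⟨fun a => ?_, (hb A).2.comp (h A).2⟩⟩
    rw [← (h A).1 a]
    change e.hom.app A (ε.app A a) = 0 ↔ _
    exact map_eq_zero_iff _ (hb A).1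

lemma isFPFunctor_of_kernel {K F G : C ⥤ AddCommGrpCat.{v}} (i : K ⟶ F) (α : F ⟶ G)
    (hi : ∀ A, Function.Injective (i.app A)) (hK : K.Additive)
    (he : ∀ A, Function.Exact (i.app A) (α.app A))
    (hF : isFPFunctor C F) (hG : isFPFunctor C G) : isFPFunctor C K := by
  have := hF.additive
  have := hG.additive
  obtain ⟨X, Y, f, x, hx, hf⟩ := (isFPFunctor_iff F).1 hF
  obtain ⟨X', Y', g, x', hx', hg⟩ := (isFPFunctor_iff G).1 hG
  obtain ⟨h, hh⟩ := hx' X (α.app X x)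
  have hp : α.app _ (F.map (pushout.inl h g) x) = 0 := by
    rw [app_map, ← hh, ← fmap_comp, pushout.condition, fmap_comp, (hg _ g).2 ⟨𝟙 _, by simp⟩,
      map_zero]
  obtain ⟨p, hp⟩ := (he _ _).1 hp
  refine (isFPFunctor_iff K).2 ⟨pushout h g, pushout (pushout.inl h g) f, pushout.inl _ _, p,
    fun A k => ?_, fun A c => ?_⟩
  · obtain ⟨a, ha⟩ := hx A (i.app A k)
    have h0 : G.map (h ≫ a) x' = 0 := by
      rw [fmap_comp, hh, ← app_map, ha]
      exact (he A _).2 ⟨k, rfl⟩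
    obtain ⟨b, hb⟩ := (hg _ _).1 h0
    refine ⟨pushout.desc a b hb.symm, hi A ?_⟩
    rw [app_map, hp, ← fmap_comp, pushout.inl_desc, ha]
  · have : K.map c p = 0 ↔ F.map (pushout.inl h g ≫ c) x = 0 := by
      rw [fmap_comp, ← hp, ← app_map, map_eq_zero_iff _ (hi A)]
    rw [this, hf]
    constructor
    · rintro ⟨d, hd⟩
      exact ⟨pushout.desc c d hd.symm, pushout.inl_desc _ _ _⟩
    · rintro ⟨d, rfl⟩
      exact ⟨pushout.inr _ _ ≫ d, by rw [← Category.assoc, ← pushout.condition, Category.assoc]⟩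

lemma isFPFunctor_of_cokernel {F G Q : C ⥤ AddCommGrpCat.{v}} (α : F ⟶ G) (q : G ⟶ Q)
    (hq : ∀ A, Function.Surjective (q.app A)) (hQ : Q.Additive)
    (he : ∀ A, Function.Exact (α.app A) (q.app A))
    (hF : isFPFunctor C F) (hG : isFPFunctor C G) : isFPFunctor C Q := by
  have := hF.additive
  have := hG.additive
  obtain ⟨X, Y, f, x, hx, hf⟩ := (isFPFunctor_iff F).1 hF
  obtain ⟨X', Y', g, x', hx', hg⟩ := (isFPFunctor_iff G).1 hG
  obtain ⟨h, hh⟩ := hx' X (α.app X x)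
  refine (isFPFunctor_iff Q).2 ⟨X', X ⊞ Y', biprod.lift h g, q.app _ x',
    fun A y => ?_, fun A a => ?_⟩
  · obtain ⟨z, rfl⟩ := hq A y
    obtain ⟨a, rfl⟩ := hx' A z
    exact ⟨a, (app_map q a x').symm⟩
  · rw [← app_map, he A]
    constructor
    · rintro ⟨y, hy⟩
      obtain ⟨b, rfl⟩ := hx A y
      rw [app_map, ← hh, ← fmap_comp] at hy
      have h0 : G.map (a - h ≫ b) x' = 0 := by
        have := fmap_add G x' (a - h ≫ b) (h ≫ b)
        rw [sub_add_cancel, hy] at this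
        exact right_eq_add.1 this
      obtain ⟨c, hc⟩ := (hg _ _).1 h0
      exact ⟨biprod.desc b c, by rw [biprod.lift_desc, hc]; abel⟩
    · rintro ⟨d, rfl⟩
      refine ⟨F.map (biprod.inl ≫ d) x, ?_⟩
      have e : biprod.lift h g ≫ d = h ≫ biprod.inl ≫ d + g ≫ biprod.inr ≫ d := by
        rw [biprod.lift_eq]; simp
      rw [app_map, ← hh, e, fmap_add, (hg _ _).2 ⟨_, rfl⟩, add_zero, ← fmap_comp]

instance isFPFunctor_kernels : (isFPFunctor C).IsClosedUnderKernels where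
  kernels_le := by
    rintro K ⟨α, k, hk, hF, hG⟩
    have := Fork.IsLimit.mono hk
    have hm : ∀ A, Function.Injective (k.ι.app A) := fun A =>
      (AddCommGrpCat.mono_iff_injective _).1 ((NatTrans.mono_iff_mono_app _).1 ‹_› A)
    have ha := hF.additive
    exact isFPFunctor_of_kernel k.ι α hm
      ((additiveFunctor C AddCommGrpCat.{v}).prop_of_mono k.ι ha)
      (exact_app (w := k.condition) (ShortComplex.exact_of_f_is_kernel _
        (IsLimit.ofIsoLimit hk (Fork.ext (Iso.refl _) (by simp))))) hF hG

instance isFPFunctor_cokernels : (isFPFunctor C).IsClosedUnderCokernels where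
  cokernels_le := by
    rintro Q ⟨α, k, hk, hF, hG⟩
    have := Cofork.IsColimit.epi hk
    have hm : ∀ A, Function.Surjective (k.π.app A) := fun A =>
      (AddCommGrpCat.epi_iff_surjective _).1 ((NatTrans.epi_iff_epi_app _).1 ‹_› A)
    have ha := hG.additive
    exact isFPFunctor_of_cokernel α k.π hm
      ((additiveFunctor C AddCommGrpCat.{v}).prop_of_epi k.π ha)
      (exact_app (w := k.condition) (ShortComplex.exact_of_g_is_cokernel _
        (IsColimit.ofIsoColimit hk (Cofork.ext (Iso.refl _) (by simp))))) hF hG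

lemma isFPFunctor_coyoneda (X : C) : isFPFunctor C (preadditiveCoyoneda.obj (op X)) := by
  refine (isFPFunctor_iff _).2 ⟨X, 0, 0, 𝟙 X, fun A a => ⟨a, Category.id_comp a⟩, fun A a => ?_⟩
  change 𝟙 X ≫ a = 0 ↔ _
  rw [Category.id_comp]
  exact ⟨fun h => ⟨0, by simp [h]⟩, fun ⟨b, hb⟩ => by rw [← hb, zero_comp]⟩

instance isFPFunctor_containsZero : (isFPFunctor C).ContainsZero where
  exists_zero := ⟨preadditiveCoyoneda.obj (op 0),
    (preadditiveCoyoneda (C := C)).map_isZero (isZero_zero C).op, isFPFunctor_coyoneda 0⟩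

lemma isFPFunctor_biprod {F G : C ⥤ AddCommGrpCat.{v}} (hF : isFPFunctor C F)
    (hG : isFPFunctor C G) : isFPFunctor C (F ⊞ G) := by
  have := hF.additive
  have := hG.additive
  have hA : (F ⊞ G).Additive :=
    (additiveFunctor C AddCommGrpCat.{v}).prop_of_isLimit_binaryFan
      (BinaryBiproduct.isLimit F G) hF.additive hG.additive
  obtain ⟨X, Y, f, x, hx, hf⟩ := (isFPFunctor_iff F).1 hF
  obtain ⟨X', Y', g, x', hx', hg⟩ := (isFPFunctor_iff G).1 hG
  have t : ∀ A (y : (F ⊞ G).obj A), y = (biprod.inl : F ⟶ F ⊞ G).app A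
      ((biprod.fst : F ⊞ G ⟶ F).app A y) + (biprod.inr : G ⟶ F ⊞ G).app A
      ((biprod.snd : F ⊞ G ⟶ G).app A y) := fun A y =>
    congr($(NatTrans.congr_app (biprod.total (X := F) (Y := G)) A) y).symm
  have hfst : ∀ A (y : F.obj A) (z : G.obj A), (biprod.fst : F ⊞ G ⟶ F).app A
      ((biprod.inl : F ⟶ F ⊞ G).app A y + (biprod.inr : G ⟶ F ⊞ G).app A z) = y :=
    fun A y z => by
      have h1 := congr($(NatTrans.congr_app (biprod.inl_fst (X := F) (Y := G)) A) y)
      have h2 := congr($(NatTrans.congr_app (biprod.inr_fst (X := F) (Y := G)) A) z)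
      rw [map_add]
      exact (congrArg₂ (· + ·) h1 h2).trans (add_zero y)
  have hsnd : ∀ A (y : F.obj A) (z : G.obj A), (biprod.snd : F ⊞ G ⟶ G).app A
      ((biprod.inl : F ⟶ F ⊞ G).app A y + (biprod.inr : G ⟶ F ⊞ G).app A z) = z :=
    fun A y z => by
      have h1 := congr($(NatTrans.congr_app (biprod.inl_snd (X := F) (Y := G)) A) y)
      have h2 := congr($(NatTrans.congr_app (biprod.inr_snd (X := F) (Y := G)) A) z)
      rw [map_add]
      exact (congrArg₂ (· + ·) h1 h2).trans (zero_add z)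
  have key : ∀ A (c : X ⊞ X' ⟶ A), (F ⊞ G).map c
      ((biprod.inl : F ⟶ F ⊞ G).app _ (F.map biprod.inl x) +
        (biprod.inr : G ⟶ F ⊞ G).app _ (G.map biprod.inr x')) =
      (biprod.inl : F ⟶ F ⊞ G).app _ (F.map (biprod.inl ≫ c) x) +
        (biprod.inr : G ⟶ F ⊞ G).app _ (G.map (biprod.inr ≫ c) x') := fun A c => by
    rw [map_add, ← app_map, ← app_map, ← fmap_comp, ← fmap_comp]
  refine (isFPFunctor_iff _).2 ⟨X ⊞ X', Y ⊞ Y', biprod.map f g,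
    (biprod.inl : F ⟶ F ⊞ G).app _ (F.map biprod.inl x) +
      (biprod.inr : G ⟶ F ⊞ G).app _ (G.map biprod.inr x'), fun A y => ?_, fun A c => ?_⟩
  · obtain ⟨a, ha⟩ := hx A ((biprod.fst : F ⊞ G ⟶ F).app A y)
    obtain ⟨b, hb⟩ := hx' A ((biprod.snd : F ⊞ G ⟶ G).app A y)
    exact ⟨biprod.desc a b, by rw [key, biprod.inl_desc, biprod.inr_desc, ha, hb, ← t]⟩
  · have e : (F ⊞ G).map c ((biprod.inl : F ⟶ F ⊞ G).app _ (F.map biprod.inl x) +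
        (biprod.inr : G ⟶ F ⊞ G).app _ (G.map biprod.inr x')) = 0 ↔
        F.map (biprod.inl ≫ c) x = 0 ∧ G.map (biprod.inr ≫ c) x' = 0 := by
      rw [key]
      refine ⟨fun h => ⟨?_, ?_⟩, fun ⟨h1, h2⟩ => by rw [h1, h2, map_zero, map_zero, add_zero]⟩
      · rw [← hfst A (F.map (biprod.inl ≫ c) x) (G.map (biprod.inr ≫ c) x'), h, map_zero]
      · rw [← hsnd A (F.map (biprod.inl ≫ c) x) (G.map (biprod.inr ≫ c) x'), h, map_zero]
    rw [e, hf, hg]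
    constructor
    · rintro ⟨⟨b, hb⟩, ⟨b', hb'⟩⟩
      exact ⟨biprod.desc b b', by ext <;> simp [hb, hb']⟩
    · rintro ⟨d, rfl⟩
      exact ⟨⟨biprod.inl ≫ d, by simp⟩, ⟨biprod.inr ≫ d, by simp⟩⟩

instance isFPFunctor_finiteProducts : (isFPFunctor C).IsClosedUnderFiniteProducts := by
  have : (isFPFunctor C).IsClosedUnderBinaryProducts := ⟨by
    rintro F ⟨p⟩
    have h1 := p.prop_diag_obj ⟨WalkingPair.left⟩
    have h2 := p.prop_diag_obj ⟨WalkingPair.right⟩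
    refine (isFPFunctor C).prop_of_iso ?_ (isFPFunctor_biprod h1 h2)
    exact IsLimit.conePointsIsoOfNatIso (BinaryBiproduct.isLimit _ _) p.isLimit
      (diagramIsoPair p.diag).symm⟩
  exact .mk'

variable (C) in
/-- The category of finitely presented functors `C ⥤ Ab`. -/
abbrev FPFunctor := (isFPFunctor C).FullSubcategory

variable (C) in
/-- The contravariant Yoneda embedding `X ↦ Hom (X, -)`. -/
def yon : Cᵒᵖ ⥤ FPFunctor C :=
  (isFPFunctor C).lift preadditiveCoyoneda fun X => isFPFunctor_coyoneda X.unop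

instance : (yon C).Additive where
  map_add {X Y f g} := by
    ext A (a : X.unop ⟶ A)
    exact Preadditive.add_comp _ _ _ f.unop g.unop a

lemma fp_surjective_of_epi {F G : FPFunctor C} (q : F ⟶ G) [Epi q] (A : C) :
    Function.Surjective (q.hom.app A) := by
  have := (isFPFunctor C).preservesEpimorphisms_ι_of_isNormalMonoCategory
  have h : Epi q.hom := inferInstanceAs (Epi ((isFPFunctor C).ι.map q))
  exact (AddCommGrpCat.epi_iff_surjective _).1 ((NatTrans.epi_iff_epi_app _).1 h A)

/-- The map `Hom (X, -) ⟶ F` corresponding to an element of `F X`. -/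
def ofElem (F : FPFunctor C) {X : C} (x : F.obj.obj X) : (yon C).obj (op X) ⟶ F :=
  have := F.property.additive
  ObjectProperty.homMk
    { app A := AddCommGrpCat.ofHom
        { toFun := fun a : X ⟶ A => F.obj.map a x
          map_zero' := fmap_zero F.obj x
          map_add' := fmap_add F.obj x }
      naturality A B g := by
        ext a
        exact fmap_comp F.obj a g x }

lemma ofElem_app (F : FPFunctor C) {X : C} (x : F.obj.obj X) {A : C} (a : X ⟶ A) :
    (ofElem F x).hom.app A a = F.obj.map a x := rfl

lemma yon_hom_ext {F : FPFunctor C} {X : C} {α β : (yon C).obj (op X) ⟶ F}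
    (h : α.hom.app X (𝟙 X) = β.hom.app X (𝟙 X)) : α = β := by
  ext A (a : X ⟶ A)
  have h1 := app_map α.hom a (𝟙 X)
  have h2 := app_map β.hom a (𝟙 X)
  rw [h, ← h2] at h1
  have e : ((yon C).obj (op X)).obj.map a (𝟙 X) = a := Category.id_comp a
  rwa [e] at h1

instance yon_projective (X : Cᵒᵖ) : Projective ((yon C).obj X) where
  factors {F G} α q _ := by
    induction X using Opposite.rec with | op X =>
    obtain ⟨y, hy⟩ := fp_surjective_of_epi q X (α.hom.app X (𝟙 X))
    refine ⟨ofElem F y, yon_hom_ext ?_⟩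
    refine Eq.trans ?_ hy
    change q.hom.app X (F.obj.map (𝟙 X) y) = _
    simp

instance fp_enoughProjectives : EnoughProjectives (FPFunctor C) where
  presentation F := by
    obtain ⟨X, Y, η, ε, h⟩ := F.property
    have : Epi ε := (NatTrans.epi_iff_epi_app _).2
      fun A => (AddCommGrpCat.epi_iff_surjective _).2 (h A).2
    let ε' : (yon C).obj (op X) ⟶ F := ObjectProperty.homMk ε
    have : Epi ε' := (isFPFunctor C).ι.epi_of_epi_map this
    exact ⟨{ p := (yon C).obj (op X), f := ε' }⟩

instance yon_isRightAdjoint : (yon C).IsRightAdjoint := by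
  have (F : FPFunctor C) : HasInitial (StructuredArrow F (yon C)) := by
    have hadd := F.property.additive
    obtain ⟨X, Y, f, x, hx, hf⟩ := (isFPFunctor_iff F.obj).1 F.property
    have hc : ∀ {A : C} {a b : X ⟶ A}, F.obj.map a x = F.obj.map b x →
        kernel.ι f ≫ a = kernel.ι f ≫ b := fun {A a b} h => by
      have h0 : F.obj.map (a - b) x = 0 := by
        have := fmap_add F.obj x (a - b) b
        rw [sub_add_cancel, h] at this
        exact right_eq_add.1 this
      obtain ⟨c, hc⟩ := (hf _ _).1 h0
      rw [← sub_eq_zero, ← Preadditive.comp_sub, ← hc, kernel.condition_assoc, zero_comp]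
    choose s hs using hx
    have hs' : ∀ (A : C) (y : F.obj.obj A) (a : X ⟶ A), F.obj.map a x = y →
        kernel.ι f ≫ s A y = kernel.ι f ≫ a := fun A y a h => hc ((hs A y).trans h.symm)
    let φ : F ⟶ (yon C).obj (op (kernel f)) := ObjectProperty.homMk
      { app A := AddCommGrpCat.ofHom
          { toFun := fun y => (kernel.ι f ≫ s A y : kernel f ⟶ A)
            map_zero' := (hs' _ _ 0 (fmap_zero _ _)).trans comp_zero
            map_add' := fun y z => (hs' _ _ (s A y + s A z)
              (by rw [fmap_add, hs, hs])).trans (Preadditive.comp_add _ _ _ _ _ _) }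
        naturality A B g := by
          ext y
          exact (hs' _ _ (s A y ≫ g) (by rw [fmap_comp, hs]; rfl)).trans
            (Category.assoc _ _ _).symm }
    have hφ : φ.hom.app X x = kernel.ι f :=
      (hs' X x (𝟙 X) (by simp)).trans (Category.comp_id _)
    have ext {G : FPFunctor C} {α β : F ⟶ G} (h : α.hom.app X x = β.hom.app X x) : α = β := by
      ext A y
      obtain ⟨a, rfl⟩ : ∃ a : X ⟶ A, F.obj.map a x = y := ⟨_, hs A y⟩
      have h1 := app_map α.hom a x
      have h2 := app_map β.hom a x
      exact h1.trans ((congrArg _ h).trans h2.symm)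
    refine IsInitial.hasInitial (X := StructuredArrow.mk φ) (IsInitial.ofUniqueHom (fun Z => ?_) ?_)
    · let z : Z.right.unop ⟶ X := Z.hom.hom.app X x
      have hz : z ≫ f = 0 := by
        have h1 := app_map Z.hom.hom f x
        rw [(hf _ f).2 ⟨𝟙 _, Category.comp_id _⟩, map_zero] at h1
        exact h1.symm
      exact StructuredArrow.homMk (kernel.lift f z hz).op
        (ext ((congrArg (fun t => kernel.lift f z hz ≫ t) hφ).trans (kernel.lift_ι f z hz)))
    · intro Z m
      ext
      apply Quiver.Hom.unop_inj
      rw [← cancel_mono (kernel.ι f)]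
      refine Eq.trans ?_ (kernel.lift_ι f _ _).symm
      refine (congrArg (fun t => m.right.unop ≫ t) hφ).symm.trans ?_
      exact congr(($(StructuredArrow.w m)).hom.app X x)
  exact isRightAdjointOfStructuredArrowInitials _

end FPFunctors
/-! ### Tensor products over a noncommutative ring -/

section Tensor

variable {R : Type u} [Ring R]

/-- The subgroup of `X ⊗[ℤ] L` generated by the elements `x r ⊗ l - x ⊗ r l`. -/
def balancedRel (X L : Type u) [AddCommGroup X] [Module Rᵐᵒᵖ X] [AddCommGroup L] [Module R L] :
    AddSubgroup (X ⊗[ℤ] L) :=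
  AddSubgroup.closure {z | ∃ (x : X) (r : R) (l : L),
    z = (MulOpposite.op r • x) ⊗ₜ[ℤ] l - x ⊗ₜ[ℤ] (r • l)}

variable (R) in
/-- The tensor product `X ⊗_R L` of a right `R`-module `X` (an `Rᵐᵒᵖ`-module) and a left
`R`-module `L`, as an abelian group; `R` need not be commutative. -/
abbrev RTensor (X L : Type u) [AddCommGroup X] [Module Rᵐᵒᵖ X] [AddCommGroup L] [Module R L] :
    Type u :=
  (X ⊗[ℤ] L) ⧸ balancedRel (R := R) X L

namespace RTensor

variable {X X' X'' L L' L'' : Type u}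
  [AddCommGroup X] [Module Rᵐᵒᵖ X] [AddCommGroup X'] [Module Rᵐᵒᵖ X']
  [AddCommGroup X''] [Module Rᵐᵒᵖ X'']
  [AddCommGroup L] [Module R L] [AddCommGroup L'] [Module R L']
  [AddCommGroup L''] [Module R L'']

variable (R) in
/-- The pure tensor `x ⊗ l`. -/
def tmul (x : X) (l : L) : RTensor R X L := QuotientAddGroup.mk (x ⊗ₜ[ℤ] l)

lemma tmul_add (x : X) (l l' : L) : tmul R x (l + l') = tmul R x l + tmul R x l' :=
  congrArg QuotientAddGroup.mk (TensorProduct.tmul_add x l l')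

lemma add_tmul (x x' : X) (l : L) : tmul R (x + x') l = tmul R x l + tmul R x' l :=
  congrArg QuotientAddGroup.mk (TensorProduct.add_tmul x x' l)

lemma smul_tmul (x : X) (r : R) (l : L) :
    tmul R (MulOpposite.op r • x) l = tmul R x (r • l) :=
  (QuotientAddGroup.eq_iff_sub_mem).2 (AddSubgroup.subset_closure ⟨x, r, l, rfl⟩)

lemma hom_ext {A : Type*} [AddCommGroup A] {f g : RTensor R X L →+ A}
    (h : ∀ x l, f (tmul R x l) = g (tmul R x l)) : f = g := by
  refine AddMonoidHom.ext fun z => ?_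
  obtain ⟨z, rfl⟩ := QuotientAddGroup.mk_surjective z
  induction z with
  | zero => exact (map_zero f).trans (map_zero g).symm
  | tmul x l => exact h x l
  | add y z hy hz =>
    exact (map_add f _ _).trans ((congrArg₂ (· + ·) hy hz).trans (map_add g _ _).symm)

/-- The map `f ⊗ g`. -/
def map (f : X →ₗ[Rᵐᵒᵖ] X') (g : L →ₗ[R] L') : RTensor R X L →+ RTensor R X' L' :=
  QuotientAddGroup.map _ _
    (TensorProduct.map f.toAddMonoidHom.toIntLinearMap
      g.toAddMonoidHom.toIntLinearMap).toAddMonoidHom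
    ((AddSubgroup.closure_le _).2 (by
      rintro _ ⟨x, r, l, rfl⟩
      refine AddSubgroup.subset_closure ⟨f x, r, g l, ?_⟩
      simp))

@[simp]
lemma map_tmul (f : X →ₗ[Rᵐᵒᵖ] X') (g : L →ₗ[R] L') (x : X) (l : L) :
    map f g (tmul R x l) = tmul R (f x) (g l) := rfl

end RTensor

end Tensor

/-! ### The functors `D_A` and `D_L` -/

section Functors

variable (R : Type u) [Ring R]

/-- The category of right `R`-modules. -/
abbrev RightMod := ModuleCat.{u} Rᵐᵒᵖ

/-- The left `R`-modules that are finitely presented. -/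
abbrev isFPMod : ObjectProperty (ModuleCat.{u} R) := fun M => Module.FinitePresentation R M

/-- The category of finitely presented left `R`-modules. -/
abbrev FPLeftMod := (isFPMod R).FullSubcategory

instance : EssentiallySmall.{u} (FPLeftMod R) := by
  have h : isFPMod R ≤ ModuleCat.isFG R :=
    fun M (h : Module.FinitePresentation R M) => (inferInstance : Module.Finite R M)
  have := (ObjectProperty.fullyFaithfulιOfLE h).full
  have := (ObjectProperty.fullyFaithfulιOfLE h).faithful
  exact essentiallySmall_of_fully_faithful (ObjectProperty.ιOfLE h)

/-- The category of additive functors from finitely presented left `R`-modules to abelian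
groups. -/
abbrev LeftFun := FPLeftMod R ⥤+ AddCommGrpCat.{u}

/-- The category of finitely presented functors from right `R`-modules to abelian groups. -/
abbrev FPFun := FPFunctor (RightMod R)

/-- The tensor embedding `X ↦ X ⊗_R -`. -/
def tensorEmb : RightMod R ⥤ LeftFun R where
  obj X :=
    { obj :=
        { obj L := AddCommGrpCat.of (RTensor R X L.obj)
          map g := AddCommGrpCat.ofHom (RTensor.map LinearMap.id g.hom.hom)
          map_id L := AddCommGrpCat.hom_ext (RTensor.hom_ext fun _ _ => rfl)
          map_comp f g := AddCommGrpCat.hom_ext (RTensor.hom_ext fun _ _ => rfl) }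
      property := ⟨fun {L L' f g} => AddCommGrpCat.hom_ext (RTensor.hom_ext fun x l =>
        RTensor.tmul_add x (f.hom.hom l) (g.hom.hom l))⟩ }
  map f := ObjectProperty.homMk
    { app L := AddCommGrpCat.ofHom (RTensor.map f.hom LinearMap.id)
      naturality L L' g := AddCommGrpCat.hom_ext (RTensor.hom_ext fun _ _ => rfl) }
  map_id X := by
    ext L : 4
    exact RTensor.hom_ext fun _ _ => rfl
  map_comp f g := by
    ext L : 4
    exact RTensor.hom_ext fun _ _ => rfl

instance : (tensorEmb R).Additive where
  map_add {X Y f g} := by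
    ext L : 4
    exact RTensor.hom_ext fun x l => RTensor.add_tmul (f.hom x) (g.hom x) l

/-- `R` as a finitely presented left module over itself. -/
def regMod : FPLeftMod R := ⟨ModuleCat.of R R, inferInstanceAs (Module.FinitePresentation R R)⟩

variable {R} in
/-- Right multiplication by `r`, an endomorphism of the left module `R`. -/
def rightMul (r : R) : regMod R ⟶ regMod R :=
  ObjectProperty.homMk (ModuleCat.ofHom (LinearMap.toSpanSingleton R R r))

/-- For an additive functor `G`, the group `G R` is a right `R`-module, where `r` acts by
`G (s ↦ s r)`. -/
instance evModule (G : LeftFun R) : Module Rᵐᵒᵖ (G.obj.obj (regMod R)) where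
  smul r x := G.obj.map (rightMul r.unop) x
  one_smul x := by
    have : rightMul (1 : R) = 𝟙 (regMod R) := by
      ext; exact mul_one (1 : R)
    change G.obj.map (rightMul (1 : R)) x = x
    rw [this]; simp
  mul_smul a b x := by
    have : rightMul (b.unop * a.unop) = rightMul b.unop ≫ rightMul a.unop := by
      ext; exact (mul_assoc (1 : R) b.unop a.unop).symm
    change G.obj.map (rightMul (b.unop * a.unop)) x = G.obj.map _ (G.obj.map _ x)
    rw [this, fmap_comp]
  smul_zero a := map_zero _
  smul_add a x y := map_add _ _ _
  add_smul a b x := by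
    have : rightMul (a.unop + b.unop) = rightMul a.unop + rightMul b.unop := by
      ext; exact mul_add (1 : R) a.unop b.unop
    change G.obj.map (rightMul (a.unop + b.unop)) x = _
    rw [this, fmap_add]; rfl
  zero_smul x := by
    have : rightMul (0 : R) = 0 := by
      ext; exact mul_zero (1 : R)
    change G.obj.map (rightMul (0 : R)) x = 0
    rw [this, fmap_zero]

/-- Evaluation at `R`. -/
def evR : LeftFun R ⥤ RightMod R where
  obj G := ModuleCat.of Rᵐᵒᵖ (G.obj.obj (regMod R))
  map α := ModuleCat.ofHom
    { toFun := α.hom.app (regMod R)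
      map_add' := map_add _
      map_smul' r x := app_map α.hom (rightMul r.unop) x }
  map_id _ := rfl
  map_comp _ _ := rfl

instance : (evR R).Additive where
  map_add := rfl

/-- The Yoneda embedding `X ↦ (X, -)` of right modules, contravariant. -/
abbrev Y : (RightMod R)ᵒᵖ ⥤ FPFun R := yon (RightMod R)

/-- The left adjoint of the Yoneda embedding (viewed as a functor to the opposite category). -/
def w : FPFun R ⥤ (RightMod R)ᵒᵖ := (Y R).leftAdjoint

/-- The adjunction `Nat (F, (X, -)) ≅ (X, w F)`. -/
def wAdj : w R ⊣ Y R := Adjunction.ofIsRightAdjoint (Y R)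

instance : (w R).Additive := (wAdj R).left_adjoint_additive

/-- The contravariant functor `F ↦ w F ⊗ -`. -/
abbrev tw : (FPFun R)ᵒᵖ ⥤ LeftFun R := (w R).leftOp ⋙ tensorEmb R

/-- The contravariant functor `G ↦ (G R, -)`. -/
abbrev Yev : (LeftFun R)ᵒᵖ ⥤ FPFun R := (evR R).op ⋙ Y R

/-- The Auslander-Gruson-Jensen functor `D_A = R_0 (t ∘ w)`: the zeroth right derived functor of
the contravariant functor `F ↦ w F ⊗ -`. Injective resolutions in the opposite category are
projective resolutions in the category of finitely presented functors, so `D_A F` is the kernel of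
`t (w P₀) ⟶ t (w P₁)` for a projective presentation `P₁ ⟶ P₀ ⟶ F ⟶ 0`. -/
def DA : (FPFun R)ᵒᵖ ⥤ LeftFun R := (tw R).rightDerived 0

/-- The functor `D_L = L^0 (Y ∘ ev_R)`: the zeroth left derived functor of the contravariant functor
`G ↦ (G R, -)`. It is computed by injective copresentations of `G`. -/
def DL : (LeftFun R)ᵒᵖ ⥤ FPFun R := (Yev R).leftDerived 0

/-- The covariant composition `D_L D_A`. -/
def DLDA : FPFun R ⥤ FPFun R := (DA R).rightOp ⋙ DL R

variable {R} in
/-- The natural map `X ⟶ ev_R (X ⊗ -) = X ⊗ R`, `x ↦ x ⊗ 1`. -/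
def tensorUnit (X : RightMod R) : X ⟶ (evR R).obj ((tensorEmb R).obj X) :=
  ModuleCat.ofHom
    { toFun x := RTensor.tmul R (L := R) x 1
      map_add' x y := RTensor.add_tmul x y 1
      map_smul' r x := (RTensor.smul_tmul x r.unop (1 : R)).trans
        (congrArg (RTensor.tmul R x) ((mul_one r.unop).trans (one_mul r.unop).symm)) }

variable {R} in
/-- The morphism `γ` at a representable functor: `D_L (D_A (X, -)) ⟶ D_L (X ⊗ -) ⟶ (X ⊗ R, -)
⟶ (X, -)`. The first map is `D_L` of the canonical map `X ⊗ - ⟶ D_A (X, -)`, the second one is the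
canonical map `L^0 (Y ∘ ev_R) ⟶ Y ∘ ev_R` at `X ⊗ -`, and `X` is identified with `w (X, -)` through
the counit of the adjunction. For an injective copresentation `0 ⟶ X ⊗ - ⟶ M ⊗ - ⟶ N ⊗ -` it is
the map induced by `(M, -) ⟶ (X, -)` on the cokernel of `(N, -) ⟶ (M, -)`. -/
def gammaRep (X : RightMod R) : (DLDA R).obj ((Y R).obj (op X)) ⟶ (Y R).obj (op X) :=
  (DL R).map ((tw R).toRightDerivedZero.app (op ((Y R).obj (op X)))).op ≫
    (Yev R).fromLeftDerivedZero.app (op ((tw R).obj (op ((Y R).obj (op X))))) ≫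
    (Y R).map (((wAdj R).counit.app (op X)).unop ≫ tensorUnit _).op

/-- Exactness of `A ⟶ B ⟶ D` at `B`. -/
def ExactPair {C : Type*} [Category* C] [HasZeroMorphisms C] {A B D : C} (f : A ⟶ B) (g : B ⟶ D) :
    Prop :=
  ∃ h : f ≫ g = 0, (ShortComplex.mk f g h).Exact

variable {R} in
/-- `γ : D_L D_A ⟶ 1` is the natural transformation whose component at `F` is, for each presentation
`(Z, -) ⟶ (X, -) ⟶ F ⟶ 0`, the unique morphism such that the square with vertical maps `γ` at
`(X, -)` and at `F` commutes. -/
def IsGamma (γ : DLDA R ⟶ 𝟭 (FPFun R)) : Prop :=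
  ∀ (F : FPFun R) (X Z : RightMod R) (η : (Y R).obj (op Z) ⟶ (Y R).obj (op X))
    (ε : (Y R).obj (op X) ⟶ F), ExactPair η ε → Epi ε →
    ∀ g : (DLDA R).obj F ⟶ F, (DLDA R).map ε ≫ g = gammaRep X ≫ ε ↔ g = γ.app F

variable {R} in
/-- A short exact sequence of right modules that stays exact under `- ⊗ L` for each finitely
presented left module `L`. -/
def IsPureExact (S : ShortComplex (RightMod R)) : Prop :=
  S.ShortExact ∧ (S.map (tensorEmb R)).ShortExact

variable {R} in
/-- `F` arises from a pure exact sequence `0 ⟶ X₁ ⟶ X₂ ⟶ X₃ ⟶ 0`: there is an exact sequence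
`0 ⟶ (X₃, -) ⟶ (X₂, -) ⟶ (X₁, -) ⟶ F ⟶ 0`. -/
def ArisesFromPureExact (F : FPFun R) : Prop :=
  ∃ S : ShortComplex (RightMod R), IsPureExact S ∧
    ∃ ε : (Y R).obj (op S.X₁) ⟶ F,
      Mono ((Y R).map S.g.op) ∧ ExactPair ((Y R).map S.g.op) ((Y R).map S.f.op) ∧
      ExactPair ((Y R).map S.f.op) ε ∧ Epi ε

end Functors

end AGJ

end

/-! The theorem holds because `DA`, although defined as a derived functor, is exact, and because it
inverts every component of `γ`.

Exactness. A zeroth right derived functor is left exact, so `(DA R).rightOp`, with values in the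
opposite category, preserves finite colimits. On a representable `(X, -)`, which is projective and
satisfies `w (X, -) ≅ X`, it gives `X ⊗ -` (`DAYon`). A map `(Z, -) ⟶ (X, -)` comes from some `X ⟶
Z`; with `W` its cokernel, right exactness of the tensor product makes `X ⊗ - ⟶ Z ⊗ - ⟶ W ⊗ - ⟶ 0`
exact. This one extra step of exactness on representables is enough for `DA` to turn monomorphisms
into epimorphisms (`preservesMonomorphisms_of_presentations`).

Inverting `γ`. Both sides of `DA` applied to `γ` are right exact into the opposite category, so
representables suffice. There the claim is that `DA` inverts `L⁰(Y ∘ ev_R) ⟶ Y ∘ ev_R` at `X ⊗ -`,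
that is, that the comparison between `DA (DL G)` and `G R ⊗ -` is an isomorphism for `G = X ⊗ -`
(`isIso_DADLComparison`). It is one for injective `G`. Injective functors are right exact, hence are
themselves tensor functors `G R ⊗ -` (`evalTensor_bijective`). So an injective copresentation of `X
⊗ -` stays exact under `G ↦ G R ⊗ -`, and the comparison passes from the injectives to `X ⊗ -`.

Conclusion. `DA` vanishes on the kernel and cokernel of `γ`. If `DA F = 0` and `F` is the cokernel
of `(Z, -) ⟶ (X, -)`, then `X ⊗ - ⟶ Z ⊗ -` is a monomorphism, so `X ⟶ Z` is a pure monomorphism and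
`F` arises from the pure exact sequence it begins (`arisesFromPureExact_of_isZero`). -/

noncomputable section
namespace AGJ

/-! ### Zeroth derived functors are exact on one side -/

section DerivedZero

universe v₁ v₂ u₁ u₂

variable {C : Type u₁} [Category.{v₁} C] [Abelian C] {D : Type u₂} [Category.{v₂} D] [Abelian D]

/-- A functor is right exact if it preserves the exactness of one projective presentation of each
object. -/
lemma preservesFiniteColimits_of_presentations (L : C ⥤ D) [L.Additive]
    (h : ∀ X : C, ∃ (Q P : C) (d : Q ⟶ P) (π : P ⟶ X), d ≫ π = 0 ∧ Projective Q ∧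
      Projective P ∧ Epi π ∧ Epi (L.map π) ∧
      ∀ {T : D} (t : L.obj P ⟶ T), L.map d ≫ t = 0 → ∃ s, L.map π ≫ s = t) :
    PreservesFiniteColimits L := by
  rw [Functor.preservesFiniteColimits_iff_forall_exact_map_and_epi]
  intro S hS
  have := hS.epi_g
  obtain ⟨Q, P, d, π, w, _, _, _, _, hex⟩ := h S.X₃
  obtain ⟨Q', P', d', π', w', _, _, _, _, _⟩ := h S.X₂
  let s := Projective.factorThru π S.g
  have hs : s ≫ S.g = π := Projective.factorThru_comp _ _
  have hLg : Epi (L.map S.g) := by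
    have : L.map s ≫ L.map S.g = L.map π := by rw [← L.map_comp, hs]
    exact epi_of_epi_fac this
  refine ⟨?_, hLg⟩
  let b := hS.exact.liftFromProjective (d ≫ s) (by rw [Category.assoc, hs, w])
  have hb : b ≫ S.f = d ≫ s := hS.exact.liftFromProjective_comp _ _
  -- The cokernel property of `L.map S.g`: the candidate `r` comes from restricting `t` along the
  -- lift `s` of the cover `π`.
  have key {T : D} (t : L.obj S.X₂ ⟶ T) (ht : L.map S.f ≫ t = 0) :
      ∃ r, L.map S.g ≫ r = t := by
    obtain ⟨r, hr⟩ := hex (L.map s ≫ t) (by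
      rw [← Category.assoc, ← L.map_comp, ← hb, L.map_comp, Category.assoc, ht, comp_zero])
    -- The equation for `r` is tested on the cover `P'` of `S.X₂`. There `v ≫ s` and `π'` have the
    -- same image in `S.X₃`, so they differ by a map through `S.f`, which `t` kills.
    let v := Projective.factorThru (π' ≫ S.g) π
    have hv : v ≫ π = π' ≫ S.g := Projective.factorThru_comp _ _
    let c := hS.exact.liftFromProjective (v ≫ s - π') (by
      rw [Preadditive.sub_comp, Category.assoc, hs, hv, sub_self])
    have hc : c ≫ S.f = v ≫ s - π' := hS.exact.liftFromProjective_comp _ _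
    refine ⟨r, ?_⟩
    rw [← cancel_epi (L.map π'), ← L.map_comp_assoc, ← hv, L.map_comp_assoc, hr,
      ← L.map_comp_assoc, ← sub_eq_zero, ← Preadditive.sub_comp, ← L.map_sub, ← hc, L.map_comp,
      Category.assoc, ht, comp_zero]
  choose r hr using @key
  exact ShortComplex.exact_of_g_is_cokernel _ (CokernelCofork.IsColimit.ofπ _ _
    (fun t ht => r t ht) (fun t ht => hr t ht) fun t ht m hm =>
      (cancel_epi (L.map S.g)).1 (Eq.trans hm (hr t ht).symm))

/-- A functor that agrees with an additive functor on projectives is additive if it preserves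
enough epimorphisms. -/
lemma additive_of_projectives (L F : C ⥤ D) [F.Additive] (α : L ⟶ F)
    (hα : ∀ P : C, Projective P → IsIso (α.app P))
    (h : ∀ X : C, ∃ (P : C) (π : P ⟶ X), Projective P ∧ Epi π ∧ Epi (L.map π)) :
    L.Additive where
  map_add {X Y f g} := by
    obtain ⟨P, π, _, _, _⟩ := h X
    obtain ⟨P', π', _, _, _⟩ := h Y
    let f' := Projective.factorThru (π ≫ f) π'
    let g' := Projective.factorThru (π ≫ g) π'
    have hf : f' ≫ π' = π ≫ f := Projective.factorThru_comp _ _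
    have hg : g' ≫ π' = π ≫ g := Projective.factorThru_comp _ _
    -- Since `α` is invertible at the target `P'`, additivity of `F` transfers to `L` for maps into
    -- `P'`.
    have hadd : L.map (f' + g') = L.map f' + L.map g' := by
      have := hα P' ‹_›
      rw [← cancel_mono (α.app P')]
      simp only [NatTrans.naturality, Functor.map_add, Preadditive.comp_add, Preadditive.add_comp]
    rw [← cancel_epi (L.map π), ← L.map_comp, Preadditive.comp_add, ← hf, ← hg,
      ← Preadditive.add_comp, L.map_comp, hadd, Preadditive.comp_add, ← L.map_comp π, ← L.map_comp π,
      ← hf, ← hg, L.map_comp, L.map_comp, Preadditive.add_comp]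

/-! ### Zeroth left derived functors as cokernels -/

section Left

variable (F : C ⥤ D) [F.Additive]

/-- The projection `P₀ ⟶ X` of a projective resolution. -/
def augmentation {X : C} (P : ProjectiveResolution X) : P.complex.X 0 ⟶ X := P.π.f 0

instance {X : C} (P : ProjectiveResolution X) : Epi (augmentation P) :=
  inferInstanceAs (Epi (P.π.f 0))

/-- The projection from `F P₀` to the cokernel of `F P₁ ⟶ F P₀`, for a projective resolution. -/
def toOpcycles {X : C} (P : ProjectiveResolution X) :
    F.obj (P.complex.X 0) ⟶ ((F.mapHomologicalComplex _).obj P.complex).opcycles 0 :=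
  ((F.mapHomologicalComplex _).obj P.complex).pOpcycles 0

instance {X : C} (P : ProjectiveResolution X) : Epi (toOpcycles F P) :=
  inferInstanceAs (Epi (((F.mapHomologicalComplex _).obj P.complex).pOpcycles 0))

lemma exists_toOpcycles_comp {X : C} (P : ProjectiveResolution X) {T : D}
    (t : F.obj (P.complex.X 0) ⟶ T) (ht : F.map (P.complex.d 1 0) ≫ t = 0) :
    ∃ s, toOpcycles F P ≫ s = t :=
  ⟨HomologicalComplex.descOpcycles _ t 1 (by simp) ht, HomologicalComplex.p_descOpcycles _ _ _ _ _⟩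

lemma toOpcycles_comp_opcyclesMap {X Y : C} (P : ProjectiveResolution X)
    (Q : ProjectiveResolution Y) (φ : P.complex ⟶ Q.complex) :
    toOpcycles F P ≫ HomologicalComplex.opcyclesMap ((F.mapHomologicalComplex _).map φ) 0 =
      F.map (φ.f 0) ≫ toOpcycles F Q :=
  HomologicalComplex.p_opcyclesMap _ _

lemma toOpcycles_comp_fromLeftDerivedZero' {X : C} (P : ProjectiveResolution X) :
    toOpcycles F P ≫ P.fromLeftDerivedZero' F = F.map (P.π.f 0) :=
  ProjectiveResolution.pOpcycles_comp_fromLeftDerivedZero' P F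

variable [HasProjectiveResolutions C]

/-- The isomorphism of `L₀ F X` with the cokernel of `F P₁ ⟶ F P₀`. -/
def leftDerivedZeroIsoOpcycles {X : C} (P : ProjectiveResolution X) :
    (F.leftDerived 0).obj X ≅ ((F.mapHomologicalComplex _).obj P.complex).opcycles 0 :=
  P.isoLeftDerivedObj F 0 ≪≫ ChainComplex.isoHomologyι₀ _

/-- On a projective source, the derived functor of `f` is computed by `F` of any lift of `f` to the
degree-zero term of the resolution. -/
lemma leftDerivedZero_map_comp_iso {Z X : C} [Projective Z] (P : ProjectiveResolution X)
    (f : Z ⟶ X) (g : Z ⟶ P.complex.X 0) (hg : g ≫ augmentation P = f) :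
    (F.leftDerived 0).map f ≫ (leftDerivedZeroIsoOpcycles F P).hom =
      F.fromLeftDerivedZero.app Z ≫ F.map g ≫ toOpcycles F P := by
  -- A projective object is its own resolution, concentrated in degree `0` with identity
  -- augmentation; a chain map out of it is just the map `g` in degree `0`.
  let S := ProjectiveResolution.self Z
  let φ : S.complex ⟶ P.complex := (ChainComplex.fromSingle₀Equiv _ _).symm g
  have hφ : φ.f 0 = g := ChainComplex.fromSingle₀Equiv_symm_apply_f_zero _
  have comm : φ.f 0 ≫ P.π.f 0 = S.π.f 0 ≫ f := by
    rw [hφ]; exact hg.trans (Category.id_comp f).symm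
  have h1 := ProjectiveResolution.isoLeftDerivedObj_hom_naturality f S P φ comm F 0
  have h3 : toOpcycles F S ≫ S.fromLeftDerivedZero' F = 𝟙 _ :=
    (toOpcycles_comp_fromLeftDerivedZero' F S).trans (F.map_id _)
  have h2 : HomologicalComplex.opcyclesMap ((F.mapHomologicalComplex _).map φ) 0 =
      S.fromLeftDerivedZero' F ≫ F.map g ≫ toOpcycles F P := by
    refine (cancel_epi (toOpcycles F S)).1 ((toOpcycles_comp_opcyclesMap F S P φ).trans ?_)
    refine Eq.trans ?_ (Category.assoc _ _ _)
    rw [h3, hφ]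
    exact (Category.id_comp _).symm
  rw [S.fromLeftDerivedZero_eq F]
  refine Eq.trans ?_ ((Category.assoc _ _ _).trans (congrArg (_ ≫ ·) (Category.assoc _ _ _))).symm
  refine Eq.trans ?_ (congrArg (fun t => _ ≫ _ ≫ t) h2)
  refine (Category.assoc _ _ _).symm.trans ((congrArg (· ≫ _) h1).trans ?_)
  refine (Category.assoc _ _ _).trans ?_
  exact congrArg (_ ≫ ·) (HomologicalComplex.homologyι_naturality _ _)

/-- The derived functor agrees with `F` on `P₀` and `P₁`, and on `X` it is the cokernel of `F P₁ ⟶ F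
P₀`. Hence it preserves this particular presentation, as the general criterion for right exactness
requires. -/
lemma leftDerivedZero_presentation {X : C} (P : ProjectiveResolution X) :
    Epi ((F.leftDerived 0).map (augmentation P)) ∧
    ∀ {T : D} (t : (F.leftDerived 0).obj (P.complex.X 0) ⟶ T),
      (F.leftDerived 0).map (P.complex.d 1 0) ≫ t = 0 →
      ∃ s, (F.leftDerived 0).map (augmentation P) ≫ s = t := by
  have hP (n) := P.projective n
  have h0 : IsIso (F.fromLeftDerivedZero.app (P.complex.X 0)) := inferInstance
  have h1 : IsIso (F.fromLeftDerivedZero.app (P.complex.X 1)) := inferInstance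
  let e := leftDerivedZeroIsoOpcycles F P
  have he : (F.leftDerived 0).map (augmentation P) = F.fromLeftDerivedZero.app (P.complex.X 0) ≫
        toOpcycles F P ≫ e.inv := by
    rw [← Category.assoc, Iso.eq_comp_inv]
    simpa using leftDerivedZero_map_comp_iso F P (augmentation P) (𝟙 _) (Category.id_comp _)
  refine ⟨by rw [he]; infer_instance, fun {T} t ht => ?_⟩
  obtain ⟨s, hs⟩ := exists_toOpcycles_comp F P (inv (F.fromLeftDerivedZero.app (P.complex.X 0)) ≫ t)
    (by rw [← cancel_epi (F.fromLeftDerivedZero.app (P.complex.X 1)),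
      ← F.fromLeftDerivedZero.naturality_assoc, IsIso.hom_inv_id_assoc, ht, comp_zero])
  refine ⟨e.hom ≫ s, ?_⟩
  rw [he, Category.assoc, Category.assoc, e.inv_hom_id_assoc, hs, IsIso.hom_inv_id_assoc]

instance leftDerivedZero_additive : (F.leftDerived 0).Additive :=
  additive_of_projectives _ F F.fromLeftDerivedZero (fun _ _ => inferInstance) fun X =>
    let P := projectiveResolution X
    ⟨P.complex.X 0, augmentation P, P.projective 0, inferInstance,
      (leftDerivedZero_presentation F P).1⟩

/-- The zeroth left derived functor is right exact. -/
instance leftDerivedZero_preservesFiniteColimits :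
    PreservesFiniteColimits (F.leftDerived 0) :=
  preservesFiniteColimits_of_presentations _ fun X =>
    let P := projectiveResolution X
    ⟨P.complex.X 1, P.complex.X 0, P.complex.d 1 0, augmentation P, P.complex_d_comp_π_f_zero,
      P.projective 1, P.projective 0, inferInstance, leftDerivedZero_presentation F P⟩

end Left

/-! ### Zeroth right derived functors as kernels -/

section Right

variable (F : C ⥤ D) [F.Additive]

/-- The embedding `X ⟶ I⁰` of an injective resolution. -/
def coaugmentation {X : C} (I : InjectiveResolution X) : X ⟶ I.cocomplex.X 0 := I.ι.f 0

instance {X : C} (I : InjectiveResolution X) : Mono (coaugmentation I) :=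
  inferInstanceAs (Mono (I.ι.f 0))

/-- The inclusion of the kernel of `F I⁰ ⟶ F I¹` into `F I⁰`, for an injective resolution. -/
def fromCycles {X : C} (I : InjectiveResolution X) :
    ((F.mapHomologicalComplex _).obj I.cocomplex).cycles 0 ⟶ F.obj (I.cocomplex.X 0) :=
  ((F.mapHomologicalComplex _).obj I.cocomplex).iCycles 0

instance {X : C} (I : InjectiveResolution X) : Mono (fromCycles F I) :=
  inferInstanceAs (Mono (((F.mapHomologicalComplex _).obj I.cocomplex).iCycles 0))

lemma exists_comp_fromCycles {X : C} (I : InjectiveResolution X) {T : D}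
    (t : T ⟶ F.obj (I.cocomplex.X 0)) (ht : t ≫ F.map (I.cocomplex.d 0 1) = 0) :
    ∃ s, s ≫ fromCycles F I = t :=
  ⟨HomologicalComplex.liftCycles _ t 1 (by simp) ht, HomologicalComplex.liftCycles_i _ _ _ _ _⟩

lemma cyclesMap_comp_fromCycles {X Y : C} (I : InjectiveResolution X)
    (J : InjectiveResolution Y) (φ : I.cocomplex ⟶ J.cocomplex) :
    HomologicalComplex.cyclesMap ((F.mapHomologicalComplex _).map φ) 0 ≫ fromCycles F J =
      fromCycles F I ≫ F.map (φ.f 0) :=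
  HomologicalComplex.cyclesMap_i _ _

lemma toRightDerivedZero'_comp_fromCycles {X : C} (I : InjectiveResolution X) :
    I.toRightDerivedZero' F ≫ fromCycles F I = F.map (I.ι.f 0) :=
  InjectiveResolution.toRightDerivedZero'_comp_iCycles I F

variable [HasInjectiveResolutions C]

/-- The isomorphism of `R⁰ F X` with the kernel of `F I⁰ ⟶ F I¹`. -/
def cyclesIsoRightDerivedZero {X : C} (I : InjectiveResolution X) :
    ((F.mapHomologicalComplex _).obj I.cocomplex).cycles 0 ≅ (F.rightDerived 0).obj X :=
  CochainComplex.isoHomologyπ₀ _ ≪≫ (I.isoRightDerivedObj F 0).symm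

lemma iso_comp_rightDerivedZero_map {X Z : C} [Injective Z] (I : InjectiveResolution X)
    (f : X ⟶ Z) (g : I.cocomplex.X 0 ⟶ Z) (hg : coaugmentation I ≫ g = f) :
    (cyclesIsoRightDerivedZero F I).hom ≫ (F.rightDerived 0).map f =
      fromCycles F I ≫ F.map g ≫ F.toRightDerivedZero.app Z := by
  let S := InjectiveResolution.self Z
  let φ : I.cocomplex ⟶ S.cocomplex := (CochainComplex.toSingle₀Equiv _ _).symm g
  have hφ : φ.f 0 = g := CochainComplex.toSingle₀Equiv_symm_apply_f_zero _
  have comm : I.ι.f 0 ≫ φ.f 0 = f ≫ S.ι.f 0 := by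
    rw [hφ]; exact hg.trans (Category.comp_id f).symm
  have h1 := InjectiveResolution.isoRightDerivedObj_inv_naturality f I S φ comm F 0
  have h3 : S.toRightDerivedZero' F ≫ fromCycles F S = 𝟙 _ :=
    (toRightDerivedZero'_comp_fromCycles F S).trans (F.map_id _)
  have h2 : HomologicalComplex.cyclesMap ((F.mapHomologicalComplex _).map φ) 0 =
      fromCycles F I ≫ F.map g ≫ S.toRightDerivedZero' F := by
    refine (cancel_mono (fromCycles F S)).1 ((cyclesMap_comp_fromCycles F I S φ).trans ?_)
    refine Eq.trans ?_ ((Category.assoc _ _ _).trans (congrArg (_ ≫ ·) (Category.assoc _ _ _))).symm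
    rw [h3, hφ]
    exact congrArg (_ ≫ ·) (Category.comp_id _).symm
  rw [S.toRightDerivedZero_eq F]
  refine Eq.trans ?_ (((Category.assoc _ _ _).trans
    (congrArg (_ ≫ ·) (Category.assoc _ _ _))).symm.trans (congrArg (· ≫ _) h2.symm)).symm
  refine (Category.assoc _ _ _).trans ((congrArg (_ ≫ ·) h1).trans ?_)
  refine (Category.assoc _ _ _).symm.trans (Eq.trans ?_ (Category.assoc _ _ _))
  exact congrArg (· ≫ _) (HomologicalComplex.homologyπ_naturality _ _)

lemma rightDerivedZero_copresentation {X : C} (I : InjectiveResolution X) :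
    Mono ((F.rightDerived 0).map (coaugmentation I)) ∧
    ∀ {T : D} (t : T ⟶ (F.rightDerived 0).obj (I.cocomplex.X 0)),
      t ≫ (F.rightDerived 0).map (I.cocomplex.d 0 1) = 0 →
      ∃ s, s ≫ (F.rightDerived 0).map (coaugmentation I) = t := by
  have hI (n) := I.injective n
  have h0 : IsIso (F.toRightDerivedZero.app (I.cocomplex.X 0)) := inferInstance
  have h1 : IsIso (F.toRightDerivedZero.app (I.cocomplex.X 1)) := inferInstance
  let e := cyclesIsoRightDerivedZero F I
  have he : (F.rightDerived 0).map (coaugmentation I) =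
      e.inv ≫ fromCycles F I ≫ F.toRightDerivedZero.app (I.cocomplex.X 0) := by
    rw [Iso.eq_inv_comp]
    simpa using iso_comp_rightDerivedZero_map F I (coaugmentation I) (𝟙 _) (Category.comp_id _)
  refine ⟨by rw [he]; infer_instance, fun {T} t ht => ?_⟩
  obtain ⟨s, hs⟩ := exists_comp_fromCycles F I (t ≫ inv (F.toRightDerivedZero.app (I.cocomplex.X 0)))
    (by rw [← cancel_mono (F.toRightDerivedZero.app (I.cocomplex.X 1)), Category.assoc,
      Category.assoc, F.toRightDerivedZero.naturality, IsIso.inv_hom_id_assoc, ht, zero_comp])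
  refine ⟨s ≫ e.hom, ?_⟩
  rw [he, Category.assoc, e.hom_inv_id_assoc, ← Category.assoc, hs, Category.assoc,
    IsIso.inv_hom_id, Category.comp_id]

/-- Injectives are projectives in the opposite category, so the criterion for left derived functors
applies to the opposite functor. -/
instance rightDerivedZero_additive : (F.rightDerived 0).Additive := by
  have : (F.rightDerived 0).op.Additive :=
    additive_of_projectives _ F.op (NatTrans.op F.toRightDerivedZero) (fun P _ => by
      have : IsIso (F.toRightDerivedZero.app P.unop) := inferInstance
      exact inferInstanceAs (IsIso (F.toRightDerivedZero.app P.unop).op)) fun X => by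
      let I := injectiveResolution X.unop
      have := I.injective 0
      have := (rightDerivedZero_copresentation F I).1
      exact ⟨op (I.cocomplex.X 0), (coaugmentation I).op, inferInstance,
        inferInstanceAs (Epi (coaugmentation I).op),
        inferInstanceAs (Epi ((F.rightDerived 0).map (coaugmentation I)).op)⟩
  exact ⟨fun {X Y f g} => Quiver.Hom.op_inj
    ((F.rightDerived 0).op.map_add (f := f.op) (g := g.op))⟩

/-- The zeroth right derived functor is left exact. -/
instance rightDerivedZero_preservesFiniteLimits :
    PreservesFiniteLimits (F.rightDerived 0) := by
  have : PreservesFiniteColimits (F.rightDerived 0).op :=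
    preservesFiniteColimits_of_presentations _ fun X => by
      let I := injectiveResolution X.unop
      have hI (n) := I.injective n
      obtain ⟨h1, h2⟩ := rightDerivedZero_copresentation F I
      refine ⟨op (I.cocomplex.X 1), op (I.cocomplex.X 0), (I.cocomplex.d 0 1).op,
        (coaugmentation I).op, ?_, inferInstance, inferInstance,
        inferInstanceAs (Epi (coaugmentation I).op),
        inferInstanceAs (Epi ((F.rightDerived 0).map (coaugmentation I)).op), fun {T} t ht => ?_⟩
      · exact congrArg Quiver.Hom.op I.ι_f_zero_comp_complex_d
      · obtain ⟨s, hs⟩ := h2 t.unop (congrArg Quiver.Hom.unop ht)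
        exact ⟨s.op, congrArg Quiver.Hom.op hs⟩
  exact preservesFiniteLimits_of_op _

end Right

end DerivedZero

/-! ### Right exact functors and presentations -/

section RightExact

universe v₁ v₂ v₃ u₁ u₂ u₃

variable {C : Type u₁} [Category.{v₁} C] [Abelian C] {D : Type u₂} [Category.{v₂} D] [Abelian D]

/-- The inverse of `φ.τ₂` descends to the cokernels because `φ.τ₁` is an epimorphism. Only the
target complex has to be exact. -/
lemma isIso_τ₃_of_rightExact {S S' : ShortComplex D} (φ : S ⟶ S') (hS' : S'.Exact)
    [Epi S.g] [Epi S'.g] [Epi φ.τ₁] [IsIso φ.τ₂] : IsIso φ.τ₃ := by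
  let k : S'.X₃ ⟶ S.X₃ := hS'.desc (inv φ.τ₂ ≫ S.g) (by
    rw [← cancel_epi φ.τ₁, φ.comm₁₂_assoc, IsIso.hom_inv_id_assoc, S.zero, comp_zero])
  have hk : S'.g ≫ k = inv φ.τ₂ ≫ S.g := hS'.g_desc _ _
  refine ⟨k, ?_, ?_⟩
  · rw [← cancel_epi S.g, ← φ.comm₂₃_assoc, hk, IsIso.hom_inv_id_assoc, Category.comp_id]
  · rw [← cancel_epi S'.g, ← Category.assoc, hk, Category.assoc, ← φ.comm₂₃,
      IsIso.inv_hom_id_assoc, Category.comp_id]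

lemma exists_lift_map (L : C ⥤ D) [L.PreservesZeroMorphisms] {X Y Z : C} {f : X ⟶ Y} {g : Y ⟶ Z} {w : f ≫ g = 0}
    (h : ((ShortComplex.mk f g w).map L).Exact) {T : D} (x : T ⟶ L.obj Y)
    (hx : x ≫ L.map g = 0) :
    ∃ (T' : D) (π : T' ⟶ T) (_ : Epi π) (y : T' ⟶ L.obj X), π ≫ x = y ≫ L.map f :=
  h.exact_up_to_refinements x hx

section Maps

variable (L : C ⥤ D) [PreservesFiniteColimits L] [L.PreservesZeroMorphisms] {S : ShortComplex C}

lemma exact_map_of_rightExact (hS : S.Exact) [Epi S.g] : (S.map L).Exact :=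
  hS.map_of_epi_of_preservesCokernel L inferInstance inferInstance

lemma epi_map_g_of_rightExact [Epi S.g] : Epi (S.map L).g :=
  inferInstanceAs (Epi (L.map S.g))

lemma exists_desc_map {X Y Z : C} {f : X ⟶ Y} {g : Y ⟶ Z} {w : f ≫ g = 0}
    (h : (ShortComplex.mk f g w).Exact) [Epi g] {T : D} (t : L.obj Y ⟶ T) (ht : L.map f ≫ t = 0) :
    ∃ s, L.map g ≫ s = t :=
  have : Epi (ShortComplex.mk f g w).g := ‹_›
  have := epi_map_g_of_rightExact L (S := ShortComplex.mk f g w)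
  ⟨(exact_map_of_rightExact L h).desc t ht, (exact_map_of_rightExact L h).g_desc t ht⟩

/-- A natural transformation of right exact functors that is an isomorphism on a presentation. -/
lemma isIso_app_of_presentation {L' : C ⥤ D} [PreservesFiniteColimits L']
    [L'.PreservesZeroMorphisms] (α : L ⟶ L') (hS : S.Exact) [Epi S.g] [IsIso (α.app S.X₁)]
    [IsIso (α.app S.X₂)] : IsIso (α.app S.X₃) := by
  have h1 : Epi (S.mapNatTrans α).τ₁ := inferInstanceAs (Epi (α.app S.X₁))
  have h2 : IsIso (S.mapNatTrans α).τ₂ := inferInstanceAs (IsIso (α.app S.X₂))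
  have := epi_map_g_of_rightExact L (S := S)
  have := epi_map_g_of_rightExact L' (S := S)
  exact isIso_τ₃_of_rightExact (S.mapNatTrans α)
    (exact_map_of_rightExact L' hS)

end Maps

/-! ### Extending properties from projective generators -/

section Generators

variable {E : Type u₃} [Category.{v₃} E] (P : E ⥤ C)

/-- If each object is a quotient of some `P X`, then each object has a presentation by such. -/
lemma exists_presentation (hP : ∀ F : C, ∃ (X : E) (ε : P.obj X ⟶ F), Epi ε) {F : C} {X : E}
    (ε : P.obj X ⟶ F) :
    ∃ (Z : E) (η : P.obj Z ⟶ P.obj X) (h : η ≫ ε = 0), (ShortComplex.mk η ε h).Exact := by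
  obtain ⟨Z, q, _⟩ := hP (kernel ε)
  refine ⟨Z, q ≫ kernel.ι ε, by simp, ?_⟩
  have h := ShortComplex.exact_of_f_is_kernel (ShortComplex.mk (kernel.ι ε) ε (by simp))
    (kernelIsKernel ε)
  let φ : ShortComplex.mk (q ≫ kernel.ι ε) ε (by simp) ⟶
      ShortComplex.mk (kernel.ι ε) ε (by simp) :=
    { τ₁ := q, τ₂ := 𝟙 _, τ₃ := 𝟙 _ }
  have : Epi φ.τ₁ := ‹Epi q›
  have : IsIso φ.τ₂ := inferInstanceAs (IsIso (𝟙 _))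
  have : Mono φ.τ₃ := inferInstanceAs (Mono (𝟙 _))
  exact (ShortComplex.exact_iff_of_epi_of_isIso_of_mono φ).2 h

/-- A natural transformation defined on projective generators extends from a right exact
functor. -/
lemma exists_natTrans_extension [P.Full] [∀ X, Projective (P.obj X)]
    (hP : ∀ F : C, ∃ (X : E) (ε : P.obj X ⟶ F), Epi ε) (L G : C ⥤ D) [PreservesFiniteColimits L]
    [L.PreservesZeroMorphisms] [G.PreservesZeroMorphisms] (α : P ⋙ L ⟶ P ⋙ G) :
    ∃ γ : L ⟶ G, ∀ X, γ.app (P.obj X) = α.app X := by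
  have hα {X X' : E} (f : P.obj X ⟶ P.obj X') :
      L.map f ≫ α.app X' = α.app X ≫ G.map f := by
    obtain ⟨f, rfl⟩ := P.map_surjective f
    exact α.naturality f
  -- The component is characterized against all maps from generators, not only one cover. Naturality
  -- and the value at `P.obj X` (with `ε` the identity) then follow at once.
  have key (F : C) : ∃ g : L.obj F ⟶ G.obj F, ∀ (X : E) (ε : P.obj X ⟶ F),
      L.map ε ≫ g = α.app X ≫ G.map ε := by
    obtain ⟨X, ε, _⟩ := hP F
    obtain ⟨Z, η, w, hη⟩ := exists_presentation P hP ε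
    have h0 : L.map η ≫ α.app X ≫ G.map ε = 0 := by
      rw [← Category.assoc, hα, Category.assoc]
      exact (congrArg (_ ≫ ·) ((G.map_comp _ _).symm.trans ((congrArg _ w).trans
        (G.map_zero _ _)))).trans comp_zero
    obtain ⟨g, hg⟩ := exists_desc_map L hη (α.app X ≫ G.map ε) h0
    refine ⟨g, fun X' ε' => ?_⟩
    -- Independence of the cover: projectivity makes any other map from a generator factor through
    -- `ε`.
    have hε' : Projective.factorThru ε' ε ≫ ε = ε' := Projective.factorThru_comp _ _
    rw [← hε', L.map_comp, Category.assoc, hg]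
    rw [← Category.assoc, hα, Category.assoc, G.map_comp]
  choose g hg using key
  refine ⟨{ app := g, naturality := fun F F' f => ?_ }, fun X => ?_⟩
  · obtain ⟨X, ε, _⟩ := hP F
    rw [← cancel_epi (L.map ε), ← Category.assoc, ← L.map_comp, hg, ← Category.assoc, hg,
      G.map_comp, Category.assoc]
  · have := hg _ X (𝟙 _)
    rw [L.map_id, G.map_id] at this
    exact (Category.id_comp _).symm.trans (this.trans (Category.comp_id _))

/-- A right exact functor preserves monomorphisms if each object has a presentation by generators
whose image under the functor is exact one step further to the left. -/
lemma preservesMonomorphisms_of_presentations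
    (hP : ∀ F : C, ∃ (X : E) (ε : P.obj X ⟶ F), Epi ε) (L : C ⥤ D) [PreservesFiniteColimits L]
    [L.Additive]
    (hL : ∀ {X Z : E} (f : P.obj Z ⟶ P.obj X), ∃ (W : C) (k : W ⟶ P.obj Z) (w : k ≫ f = 0),
      ((ShortComplex.mk k f w).map L).Exact) : L.PreservesMonomorphisms where
  preserves {K G} j _ := by
    -- The case of a subobject of a generator. An element killed in `L (P X)` lifts to `L (P Z)`,
    -- where it comes from `L W` by the extra exactness; but `W` already maps to zero in the kernel.
    have step {X : E} {F : C} (p : P.obj X ⟶ F) : Mono (L.map (kernel.ι p)) := by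
      obtain ⟨Z, e, _⟩ := hP (kernel p)
      obtain ⟨W, k, w, hk⟩ := hL (e ≫ kernel.ι p)
      have hke : k ≫ e = 0 := by
        rw [← cancel_mono (kernel.ι p), Category.assoc, w, zero_comp]
      refine Preadditive.mono_of_cancel_zero _ fun {T} x hx => ?_
      obtain ⟨T', π, _, z, hz⟩ := surjective_up_to_refinements_of_epi (L.map e) x
      obtain ⟨T'', π', _, y, hy⟩ := exists_lift_map L hk z (by
        rw [L.map_comp, ← Category.assoc, ← hz, Category.assoc, hx, comp_zero])
      rw [← cancel_epi π, ← cancel_epi π', hz, ← Category.assoc, hy, Category.assoc, ← L.map_comp,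
        hke]
      simp
    obtain ⟨X, r, _⟩ := hP G
    -- The general case pulls `K` back along the cover `r`. The source of `i` is the preimage of `K`
    -- in `P X`, it covers `K` through `r'`, and it contains the kernel of `r`.
    let i := kernel.ι (r ≫ cokernel.π j)
    have hij : (i ≫ r) ≫ cokernel.π j = 0 := by
      rw [Category.assoc]; exact kernel.condition _
    have hj : (ShortComplex.mk j (cokernel.π j) (cokernel.condition j)).Exact :=
      ShortComplex.exact_of_g_is_cokernel _ (cokernelIsCokernel j)
    have : Mono (ShortComplex.mk j (cokernel.π j) (cokernel.condition j)).f := ‹Mono j›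
    let r' : kernel (r ≫ cokernel.π j) ⟶ K := hj.lift (i ≫ r) hij
    have hr' : r' ≫ j = i ≫ r := hj.lift_f _ _
    have : Epi r' := by
      rw [epi_iff_surjective_up_to_refinements]
      intro T x
      obtain ⟨T', π, _, z, hz⟩ := surjective_up_to_refinements_of_epi r (x ≫ j)
      refine ⟨T', π, inferInstance, kernel.lift _ z ?_, ?_⟩
      · rw [← Category.assoc, ← hz]; simp
      · rw [← cancel_mono j, Category.assoc, Category.assoc, hr', kernel.lift_ι_assoc]
        exact hz
    let n : kernel r ⟶ kernel (r ≫ cokernel.π j) := kernel.lift _ (kernel.ι r) (by simp)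
    have hn : n ≫ i = kernel.ι r := kernel.lift_ι _ _ _
    have hnr : n ≫ r' = 0 := by
      rw [← cancel_mono j, Category.assoc, hr', ← Category.assoc, hn, kernel.condition, zero_comp]
    have hr : (ShortComplex.mk (kernel.ι r) r (kernel.condition r)).Exact :=
      ShortComplex.exact_of_f_is_kernel _ (kernelIsKernel r)
    have : Epi (ShortComplex.mk (kernel.ι r) r (kernel.condition r)).g := ‹Epi r›
    have hLr := exact_map_of_rightExact L hr
    have := step (r ≫ cokernel.π j)
    refine Preadditive.mono_of_cancel_zero _ fun {T} x hx => ?_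
    obtain ⟨T', π, _, z, hz⟩ := surjective_up_to_refinements_of_epi (L.map r') x
    -- The lift `z` dies in `L G`, so it comes from `L (kernel r)`; as `L i` is a monomorphism this
    -- already holds before applying `L i`, and `kernel r` maps to zero in `K`.
    obtain ⟨T'', π', _, y, hy⟩ := exists_lift_map L hLr (z ≫ L.map i) (by
        rw [Category.assoc, ← L.map_comp, ← hr', L.map_comp, ← Category.assoc, ← hz,
          Category.assoc, hx, comp_zero])
    have hy' : π' ≫ z = y ≫ L.map n := by
      rw [← cancel_mono (L.map i), Category.assoc, hy, Category.assoc, ← L.map_comp, hn]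
    rw [← cancel_epi π, ← cancel_epi π', hz, ← Category.assoc, hy', Category.assoc, ← L.map_comp,
      hnr]
    simp

end Generators

end RightExact

/-! ### The adjunction between the tensor embedding and evaluation at `R` -/

namespace RTensor

variable {R X L : Type u} [Ring R] [AddCommGroup X] [Module Rᵐᵒᵖ X] [AddCommGroup L] [Module R L]

/-- The homomorphism `X ⊗_R L → A` induced by a balanced biadditive map. -/
def lift {A : Type*} [AddCommGroup A] (f : X →+ L →+ A)
    (hf : ∀ x (r : R) l, f (MulOpposite.op r • x) l = f x (r • l)) : RTensor R X L →+ A :=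
  QuotientAddGroup.lift _ (TensorProduct.liftAddHom f fun r x l => by simp)
    ((AddSubgroup.closure_le _).2 (by
      rintro _ ⟨x, r, l, rfl⟩
      change TensorProduct.liftAddHom f _ _ = 0
      rw [map_sub, TensorProduct.liftAddHom_tmul, TensorProduct.liftAddHom_tmul, hf, sub_self]))

lemma tmul_zero (x : X) : tmul R x (0 : L) = 0 :=
  congrArg QuotientAddGroup.mk (TensorProduct.tmul_zero L x)

lemma zero_tmul (l : L) : tmul R (0 : X) l = 0 :=
  congrArg QuotientAddGroup.mk (TensorProduct.zero_tmul X l)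

lemma tmul_sum {ι : Type*} (s : Finset ι) (x : X) (l : ι → L) :
    tmul R x (∑ i ∈ s, l i) = ∑ i ∈ s, tmul R x (l i) :=
  map_sum (AddMonoidHom.mk' (tmul R x) (tmul_add x)) l s

lemma sum_tmul {ι : Type*} (s : Finset ι) (x : ι → X) (l : L) :
    tmul R (∑ i ∈ s, x i) l = ∑ i ∈ s, tmul R (x i) l :=
  map_sum (AddMonoidHom.mk' (fun x => tmul R x l) fun x x' => add_tmul x x' l) x s

/-- Every element of `X ⊗_R L` is a combination of a given finite generating family of `L`. -/
lemma exists_sum_tmul {n : ℕ} (l : Fin n → L) (hl : Submodule.span R (Set.range l) = ⊤)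
    (z : RTensor R X L) : ∃ x : Fin n → X, z = ∑ i, tmul R (x i) (l i) := by
  obtain ⟨z, rfl⟩ := QuotientAddGroup.mk_surjective z
  induction z with
  | zero => exact ⟨0, by simp [zero_tmul]⟩
  | tmul x a =>
    obtain ⟨c, rfl⟩ := (Submodule.mem_span_range_iff_exists_fun R).1 (hl ▸ Submodule.mem_top (x := a))
    refine ⟨fun i => MulOpposite.op (c i) • x, ?_⟩
    simp only [smul_tmul]
    exact tmul_sum _ _ _
  | add y z hy hz =>
    obtain ⟨a, ha⟩ := hy
    obtain ⟨b, hb⟩ := hz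
    refine ⟨a + b, ?_⟩
    simp only [Pi.add_apply, add_tmul, Finset.sum_add_distrib, ← ha, ← hb]
    rfl

end RTensor

section Adjunction

variable {R : Type u} [Ring R]

/-- The map `R ⟶ L` sending `1` to `l`. -/
def elemHom {L : FPLeftMod R} (l : L.obj) : regMod R ⟶ L :=
  ObjectProperty.homMk (ModuleCat.ofHom (LinearMap.toSpanSingleton R L.obj l))

lemma elemHom_add {L : FPLeftMod R} (l l' : L.obj) : elemHom (l + l') = elemHom l + elemHom l' := by
  ext; exact smul_add (1 : R) l l'

lemma elemHom_comp {L L' : FPLeftMod R} (l : L.obj) (g : L ⟶ L') :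
    elemHom l ≫ g = elemHom (g.hom.hom l) := by
  ext; exact map_smul g.hom.hom (1 : R) l

lemma elemHom_smul {L : FPLeftMod R} (r : R) (l : L.obj) :
    elemHom (r • l) = rightMul r ≫ elemHom l := by
  ext
  change (1 : R) • r • l = ((1 : R) • r) • l
  rw [smul_assoc]

lemma elemHom_one : elemHom (L := regMod R) (1 : R) = 𝟙 (regMod R) := by
  ext; exact mul_one (1 : R)

lemma op_smul_eq (G : LeftFun R) (r : R) (x : G.obj.obj (regMod R)) :
    MulOpposite.op r • x = G.obj.map (rightMul r) x := rfl

/-- The natural map `G R ⊗ L ⟶ G L`, `x ⊗ l ↦ G (s ↦ s l) x`. -/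
def evalTensor (G : LeftFun R) (L : FPLeftMod R) : RTensor R (G.obj.obj (regMod R)) L.obj →+
    G.obj.obj L :=
  RTensor.lift (AddMonoidHom.mk' (fun x => AddMonoidHom.mk' (fun l => G.obj.map (elemHom l) x)
      fun l l' => by rw [elemHom_add, fmap_add])
      fun x y => by ext l; exact map_add (G.obj.map (elemHom l)).hom x y)
    fun x r l => by
      change G.obj.map (elemHom l) (MulOpposite.op r • x) = G.obj.map (elemHom (r • l)) x
      rw [elemHom_smul, fmap_comp, op_smul_eq]

variable (R) in
/-- The tensor embedding is left adjoint to the evaluation at `R`. -/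
def tensorAdj : tensorEmb R ⊣ evR R :=
  Adjunction.mkOfUnitCounit
    { unit :=
        { app := tensorUnit
          naturality X X' f := rfl }
      counit :=
        { app G := ObjectProperty.homMk
            { app L := AddCommGrpCat.ofHom (evalTensor G L)
              naturality L L' g := AddCommGrpCat.hom_ext (RTensor.hom_ext fun x l => by
                change G.obj.map (elemHom (g.hom.hom l)) x = G.obj.map g (G.obj.map (elemHom l) x)
                rw [← elemHom_comp]
                exact fmap_comp G.obj _ _ _) }
          naturality G G' α := by
            ext L : 4
            exact RTensor.hom_ext fun x l => (app_map α.hom (elemHom l) x).symm }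
      left_triangle := by
        ext X : 2
        ext L : 4
        refine RTensor.hom_ext fun x l => ?_
        change RTensor.tmul R x ((1 : R) • l) = RTensor.tmul R x l
        rw [one_smul]
      right_triangle := by
        ext G x
        change G.obj.map (elemHom (L := regMod R) (1 : R)) x = x
        rw [elemHom_one]
        exact congr($(G.obj.map_id (regMod R)) x) }

instance : (tensorEmb R).IsLeftAdjoint := (tensorAdj R).isLeftAdjoint

/-- The inverse is the action map `x ⊗ r ↦ x r`. -/
instance tensorUnit_isIso (X : RightMod R) : IsIso (tensorUnit X) := by
  rw [ConcreteCategory.isIso_iff_bijective]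
  let f : RTensor R X R →+ X := RTensor.lift
    (AddMonoidHom.mk' (fun x => AddMonoidHom.mk' (fun r : R => MulOpposite.op r • x)
      fun r s => by rw [MulOpposite.op_add, add_smul]) fun x y => by ext r; exact smul_add _ _ _)
    fun x r s => by
      change MulOpposite.op s • MulOpposite.op r • x = MulOpposite.op (r * s) • x
      rw [smul_smul]; rfl
  refine ⟨Function.LeftInverse.injective (g := f) fun x => one_smul _ x,
    Function.RightInverse.surjective (g := f) fun z => ?_⟩
  refine DFunLike.congr_fun (RTensor.hom_ext (f := (tensorUnit X).hom.toAddMonoidHom.comp f)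
    (g := AddMonoidHom.id _) fun x r => ?_) z
  change RTensor.tmul R (MulOpposite.op r • x) (1 : R) = RTensor.tmul R x r
  rw [RTensor.smul_tmul]
  exact congrArg _ (mul_one r)

instance tensorAdj_unit_isIso (X : RightMod R) : IsIso ((tensorAdj R).unit.app X) :=
  tensorUnit_isIso X

instance tensorAdj_counit_tensorEmb_isIso (X : RightMod R) :
    IsIso ((tensorAdj R).counit.app ((tensorEmb R).obj X)) := by
  have h := (tensorAdj R).left_triangle_components X
  have : IsIso ((tensorEmb R).map ((tensorAdj R).unit.app X) ≫
    (tensorAdj R).counit.app ((tensorEmb R).obj X)) := by rw [h]; exact IsIso.id _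
  exact IsIso.of_isIso_comp_left ((tensorEmb R).map ((tensorAdj R).unit.app X)) _

end Adjunction

/-! ### Injective functors are tensor functors -/

/-! ### Injective functors are right exact -/

section PointwiseExact

variable {C : Type u} [Category.{v} C]

lemma exact_of_app (S : ShortComplex (C ⥤ AddCommGrpCat.{v}))
    (h : ∀ A, Function.Exact (S.f.app A) (S.g.app A)) : S.Exact := by
  rw [ShortComplex.exact_iff_isZero_homology, Functor.isZero_iff]
  intro A
  have hA : (S.map ((evaluation C AddCommGrpCat.{v}).obj A)).Exact :=
    (ShortComplex.ab_exact_iff_function_exact _).2 (h A)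
  exact ((ShortComplex.exact_iff_isZero_homology _).1 hA).of_iso
    (S.mapHomologyIso ((evaluation C AddCommGrpCat.{v}).obj A)).symm

variable [Preadditive C]

lemma addFun_exact_of_app (S : ShortComplex (C ⥤+ AddCommGrpCat.{v}))
    (h : ∀ A, Function.Exact (S.f.hom.app A) (S.g.hom.app A)) : S.Exact := by
  have : (additiveFunctor C AddCommGrpCat.{v}).ι.PreservesHomology :=
    { preservesKernels := (additiveFunctor C AddCommGrpCat.{v}).preservesKernels_ι
      preservesCokernels := (additiveFunctor C AddCommGrpCat.{v}).preservesCokernels_ι }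
  exact (S.exact_map_iff_of_faithful (additiveFunctor C AddCommGrpCat.{v}).ι).1
    (exact_of_app (S.map (additiveFunctor C AddCommGrpCat.{v}).ι) h)

lemma addFun_isIso_of_bijective {F G : C ⥤+ AddCommGrpCat.{v}} (α : F ⟶ G)
    (h : ∀ A, Function.Bijective (α.hom.app A)) : IsIso α := by
  have (A : C) : IsIso (α.hom.app A) := (ConcreteCategory.isIso_iff_bijective _).2 (h A)
  have h' : IsIso α.hom := NatIso.isIso_of_isIso_app _
  have : IsIso ((additiveFunctor C AddCommGrpCat.{v}).ι.map α) := h'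
  exact isIso_of_reflects_iso α (additiveFunctor C AddCommGrpCat.{v}).ι

/-- The additive functor `(A, -)`. -/
def corep (A : C) : C ⥤+ AddCommGrpCat.{v} :=
  ⟨preadditiveCoyoneda.obj (op A), inferInstanceAs (Functor.Additive (preadditiveCoyoneda.obj _))⟩

/-- The map `(B, -) ⟶ (A, -)` induced by `A ⟶ B`. -/
def corepMap {A B : C} (f : A ⟶ B) : corep B ⟶ corep A :=
  ObjectProperty.homMk (preadditiveCoyoneda.map f.op)

/-- The map `(A, -) ⟶ G` corresponding to an element of `G A`. -/
def corepHom (G : C ⥤+ AddCommGrpCat.{v}) {A : C} (y : G.obj.obj A) : corep A ⟶ G :=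
  have : G.obj.Additive := G.property
  ObjectProperty.homMk
    { app B := AddCommGrpCat.ofHom
        { toFun := fun a : A ⟶ B => G.obj.map a y
          map_zero' := fmap_zero G.obj y
          map_add' := fmap_add G.obj y }
      naturality B D g := by
        ext a
        exact fmap_comp G.obj a g y }

variable (G : C ⥤+ AddCommGrpCat.{v}) [Injective G]

/-- An epimorphism `p` gives a monomorphism `(B, -) ⟶ (A, -)`. By Yoneda, `y` is a map `(B, -) ⟶ G`;
its extension to `(A, -)`, evaluated at the identity, is a preimage of `y`. -/
lemma surjective_map_of_injective {A B : C} (p : A ⟶ B) [Epi p] :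
    Function.Surjective (G.obj.map p) := by
  intro y
  have : Mono (corepMap p) := addFun_mono_of_injective _ fun T a b (h : p ≫ a = p ≫ b) =>
    (cancel_epi p).1 h
  let φ := Injective.factorThru (corepHom G y) (corepMap p)
  have hφ : corepMap p ≫ φ = corepHom G y := Injective.comp_factorThru _ _
  refine ⟨φ.hom.app A (𝟙 A), ?_⟩
  have h1 := congr(($hφ).hom.app B (𝟙 B))
  change φ.hom.app B (p ≫ 𝟙 B) = G.obj.map (𝟙 B) y at h1
  refine (app_map φ.hom p (𝟙 A)).symm.trans
    (Eq.trans (congrArg (φ.hom.app B) ?_) (h1.trans (by simp)))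
  exact (Category.id_comp p).trans (Category.comp_id p).symm

/-- The weak cokernel property says that `(D, -) ⟶ (B, -) ⟶ (A, -)` is exact. The map `(B, -) ⟶ G`
given by `y` vanishes on `(D, -)`, so by injectivity it extends along `(B, -) ⟶ (A, -)`. -/
lemma exact_map_of_injective {A B D : C} (q : A ⟶ B) (p : B ⟶ D) (w : q ≫ p = 0)
    (h : ∀ {T : C} (t : B ⟶ T), q ≫ t = 0 → ∃ s, p ≫ s = t) (y : G.obj.obj B)
    (hy : G.obj.map p y = 0) : ∃ x, G.obj.map q x = y := by
  have hex : (ShortComplex.mk (corepMap p) (corepMap q) (by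
      ext T (a : D ⟶ T)
      change q ≫ p ≫ a = 0
      rw [← Category.assoc, w, zero_comp])).Exact :=
    addFun_exact_of_app _ fun T t => ⟨fun ht => h t ht, by
      rintro ⟨(s : D ⟶ T), rfl⟩
      change q ≫ p ≫ s = 0
      rw [← Category.assoc, w, zero_comp]⟩
  have h0 : corepMap p ≫ corepHom G y = 0 := by
    ext T (a : D ⟶ T)
    change G.obj.map (p ≫ a) y = 0
    rw [fmap_comp, hy, map_zero]
  let φ := hex.descToInjective (corepHom G y) h0
  have hφ : corepMap q ≫ φ = corepHom G y := hex.comp_descToInjective _ _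
  refine ⟨φ.hom.app A (𝟙 A), ?_⟩
  have h1 := congr(($hφ).hom.app B (𝟙 B))
  change φ.hom.app B (q ≫ 𝟙 B) = G.obj.map (𝟙 B) y at h1
  refine (app_map φ.hom q (𝟙 A)).symm.trans
    (Eq.trans (congrArg (φ.hom.app B) ?_) (h1.trans (by simp)))
  exact (Category.id_comp q).trans (Category.comp_id q).symm

end PointwiseExact

/-! ### An Eilenberg–Watts argument for injective functors -/

section Injective

variable {R : Type u} [Ring R]

variable (R) in
/-- The free left module `Rⁿ`. -/
def freeMod (n : ℕ) : FPLeftMod R :=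
  ⟨ModuleCat.of R (Fin n → R), inferInstanceAs (Module.FinitePresentation R (Fin n → R))⟩

/-- The `i`-th projection `Rⁿ ⟶ R`. -/
def freeProj {n : ℕ} (i : Fin n) : freeMod R n ⟶ regMod R :=
  ObjectProperty.homMk (ModuleCat.ofHom (LinearMap.proj i))

/-- The morphism given by a linear map. -/
def linHom {L L' : FPLeftMod R} (f : L.obj →ₗ[R] L'.obj) : L ⟶ L' :=
  ObjectProperty.homMk (ModuleCat.ofHom f)

lemma linHom_eq_sum {n : ℕ} {L : FPLeftMod R} (f : (Fin n → R) →ₗ[R] L.obj) :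
    linHom (L := freeMod R n) f = ∑ i, freeProj i ≫ elemHom (f (Pi.single i 1)) := by
  have h : f = ∑ i, (LinearMap.toSpanSingleton R L.obj (f (Pi.single i 1))).comp
      (LinearMap.proj i) := by
    ext i
    simp [Pi.single_apply]
  let φ : ((Fin n → R) →ₗ[R] L.obj) →+ (freeMod R n ⟶ L) :=
    AddMonoidHom.mk' (linHom (L := freeMod R n)) fun _ _ => rfl
  exact (congrArg φ h).trans (map_sum φ _ _)

lemma map_linHom (G : LeftFun R) {n : ℕ} {L : FPLeftMod R} (f : (Fin n → R) →ₗ[R] L.obj)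
    (y : G.obj.obj (freeMod R n)) : G.obj.map (linHom (L := freeMod R n) f) y =
      ∑ i, G.obj.map (elemHom (f (Pi.single i 1))) (G.obj.map (freeProj i) y) := by
  rw [linHom_eq_sum]
  refine (map_sum (AddMonoidHom.mk' (fun f => G.obj.map f y) (fmap_add G.obj y)) _ _).trans ?_
  exact Finset.sum_congr rfl fun i _ => fmap_comp G.obj _ _ _

lemma elemHom_freeProj {n : ℕ} (v : Fin n → R) (i : Fin n) :
    elemHom (L := freeMod R n) v ≫ freeProj i = rightMul (v i) :=
  elemHom_comp _ _

/-- The `i`-th inclusion `R ⟶ Rⁿ`. -/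
def freeIncl {n : ℕ} (i : Fin n) : regMod R ⟶ freeMod R n :=
  elemHom (L := freeMod R n) (Pi.single i (1 : R) : Fin n → R)

lemma freeIncl_linHom {n : ℕ} {L : FPLeftMod R} (f : (Fin n → R) →ₗ[R] L.obj) (i : Fin n) :
    freeIncl i ≫ linHom (L := freeMod R n) f = elemHom (f (Pi.single i 1)) :=
  elemHom_comp _ _

lemma freeIncl_freeProj {n : ℕ} (i j : Fin n) :
    freeIncl i ≫ freeProj j = rightMul ((Pi.single i (1 : R) : Fin n → R) j) :=
  elemHom_comp _ _

/-- For a presentation `Rᵐ ⟶ Rⁿ ⟶ L ⟶ 0`, the functor `G` keeps `G Rᵐ ⟶ G Rⁿ ⟶ G L ⟶ 0` exact, while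
additivity describes `G Rⁿ` by its coordinates in `G R`. The comparison with `G R ⊗ L` is then a
computation with generators and relations. -/
lemma evalTensor_bijective (G : LeftFun R) [Injective G] (L : FPLeftMod R) :
    Function.Bijective (evalTensor G L) := by
  have := L.property
  obtain ⟨n, m, f, g, hf, hfg⟩ := Module.FinitePresentation.exists_fin' R L.obj
  let p : freeMod R n ⟶ L := linHom f
  let q : freeMod R m ⟶ freeMod R n := linHom g
  have hepi : Epi p := ⟨fun {T} a b h => by
    ext x
    obtain ⟨v, rfl⟩ := hf x
    exact congr(($h).hom.hom v)⟩
  have hw : q ≫ p = 0 := by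
    ext v
    exact hfg.apply_apply_eq_zero v
  have hdesc {T : FPLeftMod R} (t : freeMod R n ⟶ T) (ht : q ≫ t = 0) : ∃ s, p ≫ s = t := by
    have hker : LinearMap.ker f ≤ LinearMap.ker t.hom.hom := fun v hv => by
      obtain ⟨u, rfl⟩ := (hfg v).1 hv
      exact congr(($ht).hom.hom u)
    let e := f.quotKerEquivOfSurjective hf
    refine ⟨linHom (((LinearMap.ker f).liftQ t.hom.hom hker).comp e.symm.toLinearMap), ?_⟩
    ext v
    have : e.symm (f v) = (LinearMap.ker f).mkQ v := e.symm_apply_eq.2 rfl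
    exact (congrArg _ this).trans ((LinearMap.ker f).liftQ_apply t.hom.hom (h := hker) v)
  have hf' (v : Fin n → R) : f v = ∑ i, v i • f (Pi.single i 1) := by
    conv_lhs => rw [← Finset.univ_sum_single v, map_sum]
    refine Finset.sum_congr rfl fun i _ => ?_
    rw [← map_smul, ← Pi.single_smul, smul_eq_mul, mul_one]
  refine ⟨(injective_iff_map_eq_zero _).2 fun z hz => ?_, fun z => ?_⟩
  · have hspan : Submodule.span R (Set.range fun i => f (Pi.single i 1)) = ⊤ := by
      refine Submodule.eq_top_iff'.2 fun a => ?_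
      obtain ⟨v, rfl⟩ := hf a
      exact (Submodule.mem_span_range_iff_exists_fun R).2 ⟨v, (hf' v).symm⟩
    obtain ⟨x, rfl⟩ := RTensor.exists_sum_tmul (fun i => f (Pi.single i 1)) hspan z
    -- The element of `G Rⁿ` with coordinates `x i`; its image in `G L` is that of the tensor, hence
    -- zero, so it comes from some `y'` in `G Rᵐ`.
    let y : G.obj.obj (freeMod R n) :=
      ∑ i, G.obj.map (freeIncl i) (x i)
    have hy : G.obj.map p y = 0 := by
      rw [← hz, map_sum, map_sum]
      refine Finset.sum_congr rfl fun i _ => ?_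
      rw [← fmap_comp, freeIncl_linHom]
      rfl
    have hx (i : Fin n) : G.obj.map (freeProj i) y = x i := by
      rw [map_sum, Finset.sum_eq_single i]
      · rw [← fmap_comp, freeIncl_freeProj, Pi.single_eq_same, ← op_smul_eq]
        exact one_smul _ _
      · intro j _ hj
        rw [← fmap_comp, freeIncl_freeProj, Pi.single_eq_of_ne hj.symm, ← op_smul_eq]
        exact zero_smul _ _
      · simp
    obtain ⟨y', hy'⟩ := exact_map_of_injective G q p hw hdesc y hy
    have hx' (i : Fin n) : x i = ∑ j, MulOpposite.op (g (Pi.single j 1) i) •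
        G.obj.map (freeProj j) y' := by
      rw [← hx, ← hy']
      refine (congrArg _ (map_linHom G (L := freeMod R n) g y')).trans ((map_sum _ _ _).trans ?_)
      refine Finset.sum_congr rfl fun j _ => ?_
      refine (fmap_comp G.obj _ _ _).symm.trans ?_
      exact congrArg (fun h => G.obj.map h (G.obj.map (freeProj j) y'))
        (elemHom_freeProj (g (Pi.single j 1)) i)
    -- Moving the matrix entries of `g` across the tensor sign turns the right-hand factors into `f
    -- (g eⱼ)`, which vanish.
    calc _ = ∑ i, ∑ j, RTensor.tmul R (G.obj.map (freeProj j) y')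
          (g (Pi.single j 1) i • f (Pi.single i 1)) := by
          refine Finset.sum_congr rfl fun i _ => ?_
          rw [hx', RTensor.sum_tmul]
          simp only [RTensor.smul_tmul]
      _ = ∑ j, RTensor.tmul R (G.obj.map (freeProj j) y') (f (g (Pi.single j 1))) := by
          rw [Finset.sum_comm]
          refine Finset.sum_congr rfl fun j _ => ?_
          rw [hf' (g _), RTensor.tmul_sum]
      _ = 0 := by
          refine Finset.sum_eq_zero fun j _ => ?_
          rw [hfg.apply_apply_eq_zero, RTensor.tmul_zero]
  · obtain ⟨y, rfl⟩ := surjective_map_of_injective G p z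
    refine ⟨∑ i, RTensor.tmul R (G.obj.map (freeProj i) y) (f (Pi.single i 1)), ?_⟩
    rw [map_sum, map_linHom]
    rfl

instance tensorAdj_counit_injective_isIso (G : LeftFun R) [Injective G] :
    IsIso ((tensorAdj R).counit.app G) :=
  addFun_isIso_of_bijective _ fun L => evalTensor_bijective G L

end Injective

/-! ### The functors `D_A` and `D_L` on representables and on injectives -/

section Duality

variable (R : Type u) [Ring R]

instance : (DA R).Additive := inferInstanceAs ((tw R).rightDerived 0).Additive

instance : PreservesFiniteLimits (DA R) :=
  inferInstanceAs (PreservesFiniteLimits ((tw R).rightDerived 0))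

instance : (DL R).Additive := inferInstanceAs ((Yev R).leftDerived 0).Additive

instance : PreservesFiniteColimits (DL R) :=
  inferInstanceAs (PreservesFiniteColimits ((Yev R).leftDerived 0))

instance : PreservesFiniteColimits (DA R).rightOp := preservesFiniteColimits_rightOp _

instance : PreservesFiniteColimits (DLDA R) := comp_preservesFiniteColimits _ _

instance : (DLDA R).Additive := inferInstanceAs ((DA R).rightOp ⋙ DL R).Additive

instance : (Y R).Full := inferInstanceAs ((isFPFunctor (RightMod R)).lift _ _).Full

instance : (Y R).Faithful := inferInstanceAs ((isFPFunctor (RightMod R)).lift _ _).Faithful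

variable {R}

lemma exists_epi_yon (F : FPFun R) : ∃ (X : (RightMod R)ᵒᵖ) (ε : (Y R).obj X ⟶ F), Epi ε := by
  obtain ⟨X, Z, η, ε, h⟩ := F.property
  have : Epi ε := (NatTrans.epi_iff_epi_app _).2
    fun A => (AddCommGrpCat.epi_iff_surjective _).2 (h A).2
  let ε' : (Y R).obj (op X) ⟶ F := ObjectProperty.homMk ε
  have : Epi ((isFPFunctor (RightMod R)).ι.map ε') := this
  exact ⟨op X, ε', (isFPFunctor (RightMod R)).ι.epi_of_epi_map this⟩

variable (R) in
/-- The canonical comparison of `D_A (X, -)` with `X ⊗ -`. -/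
def DAYon : Y R ⋙ (DA R).rightOp ⟶ (tensorEmb R).op where
  app X := ((tw R).toRightDerivedZero.app (op ((Y R).obj X))).op ≫
    (tensorEmb R).op.map ((wAdj R).counit.app X)
  naturality X X' f := by
    have h1 := (tw R).toRightDerivedZero.naturality ((Y R).map f).op
    have h2 := congrArg (tensorEmb R).op.map ((wAdj R).counit.naturality f)
    have h1' : (DA R).rightOp.map ((Y R).map f) ≫
        ((tw R).toRightDerivedZero.app (op ((Y R).obj X'))).op =
        ((tw R).toRightDerivedZero.app (op ((Y R).obj X))).op ≫
          (tensorEmb R).op.map ((w R).map ((Y R).map f)) := congrArg Quiver.Hom.op h1.symm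
    rw [Functor.map_comp, Functor.map_comp] at h2
    refine ((Category.assoc _ _ _).symm.trans (congrArg (· ≫ _) h1')).trans ?_
    refine (Category.assoc _ _ _).trans (Eq.trans ?_ (Category.assoc _ _ _).symm)
    exact congrArg (_ ≫ ·) h2

instance (X : (RightMod R)ᵒᵖ) : IsIso ((DAYon R).app X) := by
  have : Injective (op ((Y R).obj X)) := inferInstance
  have h1 : IsIso ((tw R).toRightDerivedZero.app (op ((Y R).obj X))).op := inferInstance
  have h2 : IsIso ((wAdj R).counit.app X) := inferInstance
  have h3 : IsIso ((tensorEmb R).op.map ((wAdj R).counit.app X)) := inferInstance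
  exact IsIso.comp_isIso' h1 h3

instance : IsIso (DAYon R) := NatIso.isIso_of_isIso_app _

variable (R) in
/-- The comparison of `D_A D_L G` with `G R ⊗ -`. -/
def DADLComparison : DL R ⋙ (DA R).rightOp ⟶ (evR R ⋙ tensorEmb R).op :=
  Functor.whiskerRight (Yev R).fromLeftDerivedZero (DA R).rightOp ≫
    Functor.whiskerLeft (evR R).op (DAYon R)

lemma DADLComparison_app (G : (LeftFun R)ᵒᵖ) : (DADLComparison R).app G =
    (DA R).rightOp.map ((Yev R).fromLeftDerivedZero.app G) ≫ (DAYon R).app ((evR R).op.obj G) := rfl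

instance (G : (LeftFun R)ᵒᵖ) [Projective G] : IsIso ((DADLComparison R).app G) := by
  rw [DADLComparison_app]
  have h1 : IsIso ((Yev R).fromLeftDerivedZero.app G) := inferInstance
  have h2 : IsIso ((DA R).rightOp.map ((Yev R).fromLeftDerivedZero.app G)) := inferInstance
  exact IsIso.comp_isIso' h2 inferInstance

lemma exists_projective_presentation {C : Type*} [Category* C] [Abelian C] [EnoughProjectives C]
    (X : C) : ∃ (Q P : C) (d : Q ⟶ P) (π : P ⟶ X) (w : d ≫ π = 0), Projective Q ∧ Projective P ∧
      Epi π ∧ (ShortComplex.mk d π w).Exact := by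
  obtain ⟨Q, d, w, h⟩ := exists_presentation (ObjectProperty.ι fun P : C => Projective P)
    (fun F => ⟨⟨Projective.over F, inferInstance⟩, Projective.π F,
      inferInstanceAs (Epi (Projective.π F))⟩)
    (X := ⟨Projective.over X, inferInstance⟩) (Projective.π X)
  exact ⟨Q.obj, Projective.over X, d, Projective.π X, w, Q.property, inferInstance, inferInstance, h⟩

/-- The comparison is known at injectives, which are the projectives of `(LeftFun R)ᵒᵖ`. The functor
`G ↦ G R ⊗ -` is not right exact on that category in general, so exactness of its value on the
chosen presentation has to be shown separately. -/
lemma isIso_DADLComparison (X : RightMod R) :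
    IsIso ((DADLComparison R).app (op ((tensorEmb R).obj X))) := by
  obtain ⟨Q, P, d, π, w, hQ, hP, hπ, hS⟩ :=
    exists_projective_presentation (op ((tensorEmb R).obj X))
  let S := ShortComplex.mk d π w
  have : Epi S.g := hπ
  have : Projective S.X₁ := hQ
  have : Projective S.X₂ := hP
  let θ := NatTrans.op (tensorAdj R).counit
  have hθ (G : (LeftFun R)ᵒᵖ) [Projective G] : IsIso (θ.app G) :=
    inferInstanceAs (IsIso ((tensorAdj R).counit.app G.unop).op)
  have hθX : IsIso (θ.app S.X₃) :=
    inferInstanceAs (IsIso ((tensorAdj R).counit.app ((tensorEmb R).obj X)).op)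
  let T := (evR R ⋙ tensorEmb R).op
  have hT : T.PreservesZeroMorphisms := inferInstanceAs (evR R ⋙ tensorEmb R).op.PreservesZeroMorphisms
  -- The counit `G R ⊗ - ⟶ G` is invertible at all three terms: at two because they are injective
  -- functors, at the third because it is a tensor functor. So `S.map T` inherits exactness from
  -- `S`.
  let φ : S ⟶ S.map T :=
    { τ₁ := θ.app S.X₁
      τ₂ := θ.app S.X₂
      τ₃ := θ.app S.X₃
      comm₁₂ := (θ.naturality S.f).symm
      comm₂₃ := (θ.naturality S.g).symm }
  have h1 : IsIso φ.τ₁ := hθ S.X₁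
  have h2 : IsIso φ.τ₂ := hθ S.X₂
  have h3 : IsIso φ.τ₃ := hθX
  have hφ : IsIso φ := ShortComplex.isIso_of_isIso φ
  have hTS : (S.map T).Exact := (ShortComplex.exact_iff_of_iso (asIso φ)).1 hS
  have hTg : Epi (S.map T).g := by
    have : Epi (φ.τ₂ ≫ (S.map T).g) := by
      rw [φ.comm₂₃]; exact epi_comp _ _
    exact epi_of_epi φ.τ₂ _
  have : Epi (S.map (DL R ⋙ (DA R).rightOp)).g := by
    have : PreservesFiniteColimits (DL R ⋙ (DA R).rightOp) := comp_preservesFiniteColimits _ _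
    exact epi_map_g_of_rightExact _
  have h1 : Epi (S.mapNatTrans (DADLComparison R)).τ₁ :=
    inferInstanceAs (Epi ((DADLComparison R).app S.X₁))
  have h2 : IsIso (S.mapNatTrans (DADLComparison R)).τ₂ :=
    inferInstanceAs (IsIso ((DADLComparison R).app S.X₂))
  exact isIso_τ₃_of_rightExact (S.mapNatTrans (DADLComparison R)) hTS

/-! ### The morphisms `γ` on representables and their images under `DA` -/

variable (R) in
/-- The natural transformation `D_A ⟶ t ∘ w` in the opposite category. -/
def DAToTw : (DA R).rightOp ⟶ w R ⋙ (tensorEmb R).op where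
  app F := ((tw R).toRightDerivedZero.app (op F)).op
  naturality _ _ f := congrArg Quiver.Hom.op ((tw R).toRightDerivedZero.naturality f.op).symm

variable (R) in
/-- The identification of `w (X, -) ⊗ R` with `X`. -/
def evTwYon : Y R ⋙ w R ⋙ (tensorEmb R).op ⋙ (evR R).op ⟶ 𝟭 (RightMod R)ᵒᵖ :=
  Functor.whiskerLeft (Y R ⋙ w R) (NatTrans.op (tensorAdj R).unit) ≫ (wAdj R).counit

variable (R) in
/-- The morphisms `gammaRep X`, as a natural transformation. -/
def gammaYon : Y R ⋙ DLDA R ⟶ Y R ⋙ 𝟭 (FPFun R) :=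
  Functor.whiskerLeft (Y R) (Functor.whiskerRight (DAToTw R) (DL R)) ≫
    Functor.whiskerLeft (Y R ⋙ w R ⋙ (tensorEmb R).op) (Yev R).fromLeftDerivedZero ≫
    Functor.whiskerRight (evTwYon R) (Y R)

instance (X : (RightMod R)ᵒᵖ) : IsIso ((DAToTw R).app ((Y R).obj X)) := by
  have : Injective (op ((Y R).obj X)) := inferInstance
  exact inferInstanceAs (IsIso ((tw R).toRightDerivedZero.app (op ((Y R).obj X))).op)

instance (X : (RightMod R)ᵒᵖ) : IsIso ((evTwYon R).app X) := by
  have h1 : IsIso ((tensorAdj R).unit.app ((w R).obj ((Y R).obj X)).unop).op := inferInstance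
  exact IsIso.comp_isIso' h1 inferInstance

/-- This map is the comparison for `X ⊗ -` up to the isomorphism `DAYon`. It is the only factor of
`gammaYon` that need not be invertible before `DA` is applied. -/
lemma isIso_DA_map_fromLeftDerivedZero (X : RightMod R) : IsIso ((DA R).rightOp.map
    ((Yev R).fromLeftDerivedZero.app (op ((tensorEmb R).obj X)))) := by
  have h := isIso_DADLComparison X
  rw [DADLComparison_app] at h
  exact (isIso_comp_right_iff _ _).1 h

lemma isIso_map_comp₃ {C D : Type*} [Category* C] [Category* D] (F : C ⥤ D) {W X Y Z : C}
    (f : W ⟶ X) (g : X ⟶ Y) (h : Y ⟶ Z) (hf : IsIso (F.map f)) (hg : IsIso (F.map g))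
    (hh : IsIso (F.map h)) : IsIso (F.map (f ≫ g ≫ h)) := by
  rw [F.map_comp, F.map_comp]
  infer_instance

lemma isIso_DA_map_gammaYon (X : (RightMod R)ᵒᵖ) :
    IsIso ((DA R).rightOp.map ((gammaYon R).app X)) := by
  have h1 : IsIso ((DA R).rightOp.map ((DL R).map ((DAToTw R).app ((Y R).obj X)))) :=
    inferInstance
  have h2 := isIso_DA_map_fromLeftDerivedZero ((w R).obj ((Y R).obj X)).unop
  have h3 : IsIso ((DA R).rightOp.map ((Y R).map ((evTwYon R).app X))) := inferInstance
  have e : (gammaYon R).app X = (DL R).map ((DAToTw R).app ((Y R).obj X)) ≫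
      (Yev R).fromLeftDerivedZero.app ((w R ⋙ (tensorEmb R).op).obj ((Y R).obj X)) ≫
      (Y R).map ((evTwYon R).app X) := rfl
  rw [e]
  exact isIso_map_comp₃ (DA R).rightOp _ _ _ h1 h2 h3

/-! ### Exactness of `D_A` and its kernel -/

/-- For a map of representables induced by `X ⟶ Z`, the cokernel of `X ⟶ Z` supplies the next
representable to the left, and `DAYon` turns exactness into right exactness of the tensor product.
-/
instance : (DA R).rightOp.PreservesMonomorphisms :=
  preservesMonomorphisms_of_presentations (Y R) exists_epi_yon (DA R).rightOp fun {X Z} f => by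
    obtain ⟨g, rfl⟩ := (Y R).map_surjective f
    let S : ShortComplex (RightMod R) :=
      ShortComplex.mk g.unop (cokernel.π g.unop) (cokernel.condition _)
    have hS : S.Exact := ShortComplex.exact_of_g_is_cokernel _ (cokernelIsCokernel _)
    have : Epi S.g := inferInstanceAs (Epi (cokernel.π g.unop))
    have hTS := (exact_map_of_rightExact (tensorEmb R) hS).op
    refine ⟨(Y R).obj (op (cokernel g.unop)), (Y R).map (cokernel.π g.unop).op, ?_, ?_⟩
    · rw [← Functor.map_comp]
      exact (congrArg (Y R).map (congrArg Quiver.Hom.op (cokernel.condition g.unop))).trans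
        (Functor.map_zero _ _ _)
    · exact (ShortComplex.exact_iff_of_iso (S.op.mapNatIso (asIso (DAYon R)))).2 hTS

lemma arisesFromPureExact_of_isZero {F : FPFun R} (hF : IsZero ((DA R).obj (op F))) :
    ArisesFromPureExact F := by
  obtain ⟨X, ε, _⟩ := exists_epi_yon F
  obtain ⟨Z, η, w, h⟩ := exists_presentation (Y R) exists_epi_yon ε
  obtain ⟨g, rfl⟩ := (Y R).map_surjective η
  have : Epi (ShortComplex.mk _ ε w).g := ‹_›
  -- Right exactness with vanishing last term. In the opposite category an epimorphism is a
  -- monomorphism of functors, here `X ⊗ - ⟶ Z ⊗ -`.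
  have hL : Epi ((DA R).rightOp.map ((Y R).map g)) :=
    (exact_map_of_rightExact (DA R).rightOp h).epi_f (hF.op.eq_of_tgt _ _)
  have hT : Epi ((tensorEmb R).op.map g) := by
    have : Epi ((DAYon R).app Z ≫ (tensorEmb R).op.map g) := by
      rw [← (DAYon R).naturality]
      exact epi_comp' hL inferInstance
    exact epi_of_epi ((DAYon R).app Z) _
  have hT' : Mono ((tensorEmb R).map g.unop) := unop_mono_of_epi ((tensorEmb R).op.map g)
  -- An invertible unit makes the tensor embedding fully faithful, so it reflects monomorphisms.
  have : IsIso (tensorAdj R).unit := NatIso.isIso_of_isIso_app _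
  have : (tensorEmb R).Faithful := (tensorAdj R).fullyFaithfulLOfIsIsoUnit.faithful
  have hg : Mono g.unop := (tensorEmb R).mono_of_mono_map hT'
  let S : ShortComplex (RightMod R) :=
    ShortComplex.mk g.unop (cokernel.π g.unop) (cokernel.condition _)
  have hS : S.Exact := ShortComplex.exact_of_g_is_cokernel _ (cokernelIsCokernel _)
  have hSg : Epi S.g := inferInstanceAs (Epi (cokernel.π g.unop))
  have hSf : Mono S.f := hg
  -- `Y` is a right adjoint, so it preserves kernels, and in the opposite category the cokernel
  -- sequence is a kernel sequence.
  have hYS : (S.op.map (Y R)).Exact :=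
    hS.op.map_of_mono_of_preservesKernel (Y R) (inferInstanceAs (Mono S.g.op)) inferInstance
  exact ⟨S, ⟨{ exact := hS },
    { exact := exact_map_of_rightExact (tensorEmb R) hS
      mono_f := hT'
      epi_g := epi_map_g_of_rightExact (tensorEmb R) }⟩, ε,
    inferInstanceAs (Mono ((Y R).map S.g.op)), ⟨_, hYS⟩, ⟨w, h⟩, ‹_›⟩

variable (R) in
lemma exists_isGamma : ∃ γ : DLDA R ⟶ 𝟭 (FPFun R), IsGamma γ ∧
    ∀ F, IsIso ((DA R).rightOp.map (γ.app F)) := by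
  obtain ⟨γ, hγ⟩ := exists_natTrans_extension (Y R) exists_epi_yon (DLDA R) (𝟭 (FPFun R))
    (gammaYon R)
  -- The component of `gammaYon` unfolds to `gammaRep`, since the unit of `tensorAdj` is
  -- `tensorUnit`.
  replace hγ (X : (RightMod R)ᵒᵖ) : γ.app ((Y R).obj X) = gammaRep X.unop := hγ X
  refine ⟨γ, fun F X Z η ε _ _ g => ?_, fun F => ?_⟩
  · have h : (DLDA R).map ε ≫ γ.app F = gammaRep X ≫ ε :=
      (γ.naturality ε).trans (congrArg (· ≫ ε) (hγ (op X)))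
    -- Uniqueness: `DLDA` is right exact, so it keeps `ε` an epimorphism.
    rw [← h, cancel_epi]
  · obtain ⟨X, ε, _⟩ := exists_epi_yon F
    obtain ⟨Z, η, w, h⟩ := exists_presentation (Y R) exists_epi_yon ε
    have : PreservesFiniteColimits (DLDA R ⋙ (DA R).rightOp) := comp_preservesFiniteColimits _ _
    have : (DLDA R ⋙ (DA R).rightOp).PreservesZeroMorphisms := inferInstance
    have : Epi (ShortComplex.mk _ ε w).g := ‹_›
    -- Source and target of `α` are both right exact, so invertibility at the two representables of
    -- a presentation of `F` gives it at `F`.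
    let α : DLDA R ⋙ (DA R).rightOp ⟶ (DA R).rightOp := Functor.whiskerRight γ (DA R).rightOp
    have hα (X : (RightMod R)ᵒᵖ) : IsIso (α.app ((Y R).obj X)) := by
      have e : α.app ((Y R).obj X) = (DA R).rightOp.map (gammaRep X.unop) :=
        congrArg (DA R).rightOp.map (hγ X)
      rw [e]
      exact isIso_DA_map_gammaYon X
    have key (S : ShortComplex (FPFun R)) (hS : S.Exact) (_ : Epi S.g)
        (_ : IsIso (α.app S.X₁)) (_ : IsIso (α.app S.X₂)) : IsIso (α.app S.X₃) := by
      have := (DA R).rightOp.preservesZeroMorphisms_of_additive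
      exact isIso_app_of_presentation _ α hS
    exact key (ShortComplex.mk η ε w) h ‹_› (hα Z) (hα X)

lemma isZero_of_mono_comp_isIso {C D : Type*} [Category* C] [Category* D] [Preadditive C]
    [Preadditive D] (L : C ⥤ D) [L.Additive] [L.PreservesMonomorphisms] {K F G : C} (i : K ⟶ F)
    (f : F ⟶ G) [Mono i] (w : i ≫ f = 0) [IsIso (L.map f)] : IsZero (L.obj K) := by
  refine IsZero.of_mono_eq_zero (L.map i) ?_
  rw [← cancel_mono (L.map f), ← L.map_comp, w, L.map_zero, zero_comp]

lemma isZero_of_isIso_comp_epi {C D : Type*} [Category* C] [Category* D] [Preadditive C]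
    [Preadditive D] (L : C ⥤ D) [L.Additive] [L.PreservesEpimorphisms] {F G Q : C} (f : F ⟶ G)
    (p : G ⟶ Q) [Epi p] (w : f ≫ p = 0) [IsIso (L.map f)] : IsZero (L.obj Q) := by
  refine IsZero.of_epi_eq_zero (L.map p) ?_
  rw [← cancel_epi (L.map f), ← L.map_comp, w, L.map_zero, comp_zero]

end Duality

end AGJ
end

theorem mainTheorem6 (R : Type u) [Ring R] :
    ∃ γ : AGJ.DLDA R ⟶ 𝟭 (AGJ.FPFun R), AGJ.IsGamma γ ∧
      ∃ (Kp Qp : AGJ.FPFun R ⥤ AGJ.FPFun R) (i : Kp ⟶ AGJ.DLDA R) (p : 𝟭 (AGJ.FPFun R) ⟶ Qp),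
        ∀ F : AGJ.FPFun R,
          (Mono (i.app F) ∧ AGJ.ExactPair (i.app F) (γ.app F) ∧
            AGJ.ExactPair (γ.app F) (p.app F) ∧ Epi (p.app F)) ∧
          IsZero ((AGJ.DA R).obj (op (Kp.obj F))) ∧
          IsZero ((AGJ.DA R).obj (op (Qp.obj F))) ∧
          AGJ.ArisesFromPureExact (Kp.obj F) ∧
          AGJ.ArisesFromPureExact (Qp.obj F) := by
  obtain ⟨γ, hγ, hiso⟩ := AGJ.exists_isGamma R
  refine ⟨γ, hγ, kernel γ, cokernel γ, kernel.ι γ, cokernel.π γ, fun F => ?_⟩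
  have hk : (ShortComplex.mk (kernel.ι γ) γ (kernel.condition γ)).Exact :=
    ShortComplex.exact_of_f_is_kernel _ (kernelIsKernel γ)
  have hc : (ShortComplex.mk γ (cokernel.π γ) (cokernel.condition γ)).Exact :=
    ShortComplex.exact_of_g_is_cokernel _ (cokernelIsCokernel γ)
  -- Taking kernel and cokernel of `γ` in the functor category makes functoriality automatic;
  -- evaluation at `F` is exact, so it yields the sequence at `F`.
  have hkF := hk.map ((evaluation (AGJ.FPFun R) (AGJ.FPFun R)).obj F)
  have hcF := hc.map ((evaluation (AGJ.FPFun R) (AGJ.FPFun R)).obj F)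
  have hi : Mono ((kernel.ι γ).app F) := inferInstance
  have hp : Epi ((cokernel.π γ).app F) := inferInstance
  have h1 : (kernel.ι γ).app F ≫ γ.app F = 0 := NatTrans.congr_app (kernel.condition γ) F
  have h2 : γ.app F ≫ (cokernel.π γ).app F = 0 := NatTrans.congr_app (cokernel.condition γ) F
  have := hiso F
  have hK : IsZero ((AGJ.DA R).obj (op ((kernel γ).obj F)))  :=
    (AGJ.isZero_of_mono_comp_isIso (AGJ.DA R).rightOp _ _ h1).unop
  have hQ : IsZero ((AGJ.DA R).obj (op ((cokernel γ).obj F)))  :=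
    (AGJ.isZero_of_isIso_comp_epi (AGJ.DA R).rightOp _ _ h2).unop
  exact ⟨⟨hi, ⟨h1, hkF⟩, ⟨h2, hcF⟩, hp⟩, hK, hQ, AGJ.arisesFromPureExact_of_isZero hK,
    AGJ.arisesFromPureExact_of_isZero hQ⟩
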